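/- Let $m,n$ be positive even numbers and let $T_{m,n}$ be the toroidal square grid: its vertices are the pairs $(i,j)$ with $i\in\mathbb{Z}/m$, $j\in\mathbb{Z}/n$; for every $(i,j)$ there is a horizontal edge joining $(i,j)$ to $(i,j+1)$ and a vertical edge joining $(i,j)$ to $(i+1,j)$ (so a cycle of length $2$ consists of two parallel edges). The $n$ horizontal edges of row $i$ form the horizontal cycle $C^H_i$, and the $m$ vertical edges of column $j$ form the vertical cycle $C^V_j$. Let $A$ be one layer of horizontal edges (all edges from $(i,a)$ to $(i,a+1)$, $i\in\mathbb{Z}/m$, for a fixed $a$) and let $B$ be one layer of vertical edges (all edges from $(b,j)$ to $(b+1,j)$, $j\in\mathbb{Z}/n$, for a fixed $b$). A perfect matching $M$ of $T_{m,n}$ is even if $|M\cap A|$ and $|M\cap B|$ are both even, and odd otherwise. For vectors $h=(h_0,\dots,h_{m-1})$ and $v=(v_0,\dots,v_{n-1})$ of nonnegative (in particular, of positive) integers, let $\mathcal{E}_{m,n}(h,v)$ and $\mathcal{O}_{m,n}(h,v)$ be the sets of the even, respectively odd, perfect matchings of $T_{m,n}$ that have exactly $h_i$ edges on $C^H_i$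 and exactly $v_j$ edges on $C^V_j$ for all $0\le i<m$ and $0\le j<n$. Then there is a polynomial-time computable bijection between $\mathcal{E}_{m,n}(h,v)$ and $\mathcal{O}_{m,n}(h,v)$, with polynomial-time computable inverse. More precisely, there are two algorithms, each of which takes as input positive even numbers $m,n$ and a perfect matching of $T_{m,n}$ (given as the table of the edges chosen at each vertex, row by row), runs in time polynomial in $mn$ and outputs a perfect matching of $T_{m,n}$, such that, for all such $m,n$, all layers $A,B$ and all $h,v$, the first algorithm maps $\mathcal{E}_{m,n}(h,v)$ bijectively onto $\mathcal{O}_{m,n}(h,v)$ and the second computes the inverse bijection. In particular, $|\mathcal{E}_{m,n}(h,v)|=|\mathcal{O}_{m,n}(h,v)|$. -/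

import Mathlib

namespace ToroidalGrid

/-- The cyclic successor `i + 1 mod n`. -/
def next {n : ℕ} (i : Fin n) : Fin n :=
  ⟨(i.val + 1) % n, Nat.mod_lt _ i.pos⟩

/-- The cyclic predecessor `i - 1 mod n`. -/
def prev {n : ℕ} (i : Fin n) : Fin n :=
  ⟨(i.val + (n - 1)) % n, Nat.mod_lt _ i.pos⟩

/-- The vertices `(i, j)` of the toroidal grid: `i` is the row, `j` is the column. -/
abbrev Vertex (m n : ℕ) : Type := Fin m × Fin n

/-- The edges of the toroidal grid: `horizontal i j` joins `(i, j)` to `(i, j + 1)` and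
`vertical i j` joins `(i, j)` to `(i + 1, j)`, indices taken modulo `n` and `m`.
A cycle of length two consists of two parallel edges. -/
inductive Edge (m n : ℕ) : Type
  | horizontal (i : Fin m) (j : Fin n)
  | vertical (i : Fin m) (j : Fin n)
  deriving DecidableEq, Fintype

/-- The two endpoints of an edge. -/
def Edge.ends {m n : ℕ} : Edge m n → Sym2 (Vertex m n)
  | .horizontal i j => s((i, j), (i, next j))
  | .vertical i j => s((i, j), (next i, j))

/-- The horizontal cycle in row `i`. -/
def horizontalCycle {m n : ℕ} (i : Fin m) : Finset (Edge m n) :=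
  Finset.univ.image fun j => Edge.horizontal i j

/-- The vertical cycle in column `j`. -/
def verticalCycle {m n : ℕ} (j : Fin n) : Finset (Edge m n) :=
  Finset.univ.image fun i => Edge.vertical i j

/-- The layer of all horizontal edges between column `j` and column `j + 1`. -/
def horizontalLayer {m n : ℕ} (j : Fin n) : Finset (Edge m n) :=
  Finset.univ.image fun i => Edge.horizontal i j

/-- The layer of all vertical edges between row `i` and row `i + 1`. -/
def verticalLayer {m n : ℕ} (i : Fin m) : Finset (Edge m n) :=
  Finset.univ.image fun j => Edge.vertical i j

/-- A perfect matching: a set of edges covering every vertex exactly once. -/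
def IsPerfectMatching {m n : ℕ} (M : Finset (Edge m n)) : Prop :=
  ∀ u : Vertex m n, ∃! e : Edge m n, e ∈ M ∧ u ∈ e.ends

/-- The perfect matchings of the `m × n` toroidal grid. -/
abbrev PerfectMatching (m n : ℕ) : Type :=
  {M : Finset (Edge m n) // IsPerfectMatching M}

/-- `M` contains an even number of edges of `A` and an even number of edges of `B`. -/
def IsEven {m n : ℕ} (A B : Finset (Edge m n)) (M : PerfectMatching m n) : Prop :=
  Even (M.val ∩ A).card ∧ Even (M.val ∩ B).card

/-- `M` has exactly `h i` edges on the `i`-th horizontal cycle and exactly `v j` edges on the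
`j`-th vertical cycle. -/
def HasCounts {m n : ℕ} (h : Fin m → ℕ) (v : Fin n → ℕ) (M : PerfectMatching m n) : Prop :=
  (∀ i, (M.val ∩ horizontalCycle i).card = h i) ∧ (∀ j, (M.val ∩ verticalCycle j).card = v j)

/-- The even perfect matchings with prescribed counts. -/
def evenMatchings {m n : ℕ} (A B : Finset (Edge m n)) (h : Fin m → ℕ) (v : Fin n → ℕ) :
    Set (PerfectMatching m n) :=
  {M | HasCounts h v M ∧ IsEven A B M}

/-- The odd (that is, not even) perfect matchings with prescribed counts. -/
def oddMatchings {m n : ℕ} (A B : Finset (Edge m n)) (h : Fin m → ℕ) (v : Fin n → ℕ) :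
    Set (PerfectMatching m n) :=
  {M | HasCounts h v M ∧ ¬ IsEven A B M}

/-- The instances of the algorithmic problem: a perfect matching of a toroidal grid whose
dimensions are positive even numbers. -/
structure Input where
  m : ℕ
  n : ℕ
  m_pos : 0 < m
  n_pos : 0 < n
  m_even : Even m
  n_even : Even n
  M : PerfectMatching m n

/-- The symbols of the encoding: `some (e, w, s, n)` describes a vertex, each bit telling whether
the edge leaving the vertex eastwards, westwards, southwards, northwards is chosen;
`none` is the end-of-row mark. -/
abbrev Symbol : Type := Option (Bool × Bool × Bool × Bool)

/-- The symbol describing which of the four edges at the vertex `(i, j)` belong to `M`. -/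
def symbolAt {m n : ℕ} (M : Finset (Edge m n)) (i : Fin m) (j : Fin n) : Symbol :=
  some (decide (Edge.horizontal i j ∈ M), decide (Edge.horizontal i (prev j) ∈ M),
    decide (Edge.vertical i j ∈ M), decide (Edge.vertical (prev i) j ∈ M))

/-- The word of one row, with its end mark. -/
def encodeRow {m n : ℕ} (M : Finset (Edge m n)) (i : Fin m) : List Symbol :=
  (List.finRange n).map (symbolAt M i) ++ [none]

/-- The word over the finite alphabet `Symbol` that describes an instance, row by row.
Its length is `m * (n + 1)`. -/
def encode (x : Input) : List Symbol :=
  (List.finRange x.m).flatMap (encodeRow x.M.val)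

theorem length_encode (x : Input) : (encode x).length = x.m * (x.n + 1) := by
  simp [encode, encodeRow, List.length_flatMap]

theorem count_none_encode (x : Input) : (encode x).count none = x.m := by
  have key : ∀ i : Fin x.m, (encodeRow x.M.val i).count none = 1 := by
    intro i
    simp [encodeRow, List.count_append, List.count_eq_zero, symbolAt]
  simp [encode, List.count_flatMap, Function.comp_def, key]

theorem flatMap_eq_imp {α β : Type} (f g : α → List β) (l : List α)
    (hlen : ∀ a, (f a).length = (g a).length) (h : l.flatMap f = l.flatMap g) :
    ∀ a ∈ l, f a = g a := by
  induction l with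
  | nil => simp
  | cons b l ih =>
    rw [List.flatMap_cons, List.flatMap_cons] at h
    obtain ⟨h1, h2⟩ := List.append_inj h (hlen b)
    intro a ha
    rcases List.mem_cons.1 ha with rfl | ha
    · exact h1
    · exact ih h2 a ha

/-- Different instances have different words. -/
theorem encode_injective : Function.Injective encode := by
  intro x y hxy
  have hm : x.m = y.m := by rw [← count_none_encode x, hxy, count_none_encode]
  have hl : x.m * (x.n + 1) = y.m * (y.n + 1) := by rw [← length_encode x, hxy, length_encode]
  have hn : x.n = y.n := by
    rw [← hm] at hl
    have := Nat.eq_of_mul_eq_mul_left x.m_pos hl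
    omega
  obtain ⟨m, n, p1, p2, p3, p4, M⟩ := x
  obtain ⟨m', n', q1, q2, q3, q4, M'⟩ := y
  simp only at hm hn
  subst hm hn
  have hrow : ∀ i, encodeRow M.val i = encodeRow M'.val i := fun i =>
    flatMap_eq_imp (encodeRow M.val) (encodeRow M'.val) (List.finRange m)
      (by simp [encodeRow]) hxy i (List.mem_finRange i)
  have hsym : ∀ i j, symbolAt M.val i j = symbolAt M'.val i j := by
    intro i j
    have h := List.append_cancel_right (hrow i)
    exact (List.map_inj_left.1 h) j (List.mem_finRange j)
  have hM : M = M' := by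
    apply Subtype.ext
    ext e
    cases e with
    | horizontal i j =>
      have := hsym i j
      simp only [symbolAt, Option.some.injEq, Prod.mk.injEq, decide_eq_decide] at this
      exact this.1
    | vertical i j =>
      have := hsym i j
      simp only [symbolAt, Option.some.injEq, Prod.mk.injEq, decide_eq_decide] at this
      exact this.2.2.1
  rw [hM]

/-- A family of maps, one on the perfect matchings of each toroidal grid, is polynomial-time
computable if one Turing machine, given any perfect matching of any toroidal grid with positive
even dimensions, outputs the image within a number of steps that is polynomial in the length
`m * (n + 1)` of the input word. -/
def PolyTimeComputable (F : ∀ m n : ℕ, PerfectMatching m n → PerfectMatching m n) : Prop :=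
  Nonempty (Turing.TM2ComputableInPolyTime encode encode
    fun x : Input => { x with M := F x.m x.n x.M })

end ToroidalGrid

/-! Since $m$ and $n$ are even, the torus has a chessboard colouring, and a perfect matching is the
same as a choice of one direction at every vertex, consistent along edges (`IsPairing`). From a
white vertex, walk along its matching edge and then one step further straight on (`advance`); this
leads to a white vertex again. The walk from the corner finally runs into a cycle. Match every white
vertex of this cycle with the old partner of its predecessor. A black vertex on the cycle then only
reverses its direction, so its edge stays in the same row or column cycle and all counts are
preserved (`IsShift.card_inter_shift`). After the shift the walk follows the same tail, enters the
cycle at the same place and traverses it backwards, so the construction is an involution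
(`shiftCycle_shiftCycle`).

It remains to see that the parity changes. Put the vertices on a line in lexicographic order and
draw the edges as chords. If the black partners of the white vertices are permuted by σ, then
$(-1)^{\text{crossings}}$ times the product of the comparison signs of the matched pairs is
multiplied by the sign of σ (`prod_chordSign_comp`). The comparison sign of a matched pair is the
sign of its direction, corrected by −1 for edges that wrap around. For a cycle of length ℓ the
permutation has sign $(-1)^{\ell-1}$, and reversing ℓ directions contributes $(-1)^\ell$; hence
$(-1)^{\text{crossings}+\text{wraps}}$ changes its sign (`IsShift.crossSign_mul_wrap`).

On the other hand, let $x,y$ be the parities of the numbers of edges in the layers $A,B$. Counting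
directly modulo 2, there are $\sum_j j v_j + xy$ crossings (`sum_crossing`) and $x+y$ wraps
(`wrapCount_eq`). The $v_j$ do not change, so $xy+x+y$ does; it vanishes modulo 2 exactly if
$x=y=0$, that is, for even matchings.

For the algorithm, the tail and the cycle need not be known in advance. Let the walk redirect the
vertices as it goes (`walkStep`). When it meets its own trace, the redirected vertices lead it back
along the tail, which it thereby repairs, and it stops at the corner after at most $2mn$ steps
(`exists_walk`). A stack machine performs each step in time linear in the input length. -/

namespace ToroidalGrid

/-! ### Perfect matchings as consistent choices of directions -/

/-- The four directions in which an edge can leave a vertex. -/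
inductive Dir : Type
  | east
  | west
  | south
  | north
  deriving DecidableEq

instance : Fintype Dir :=
  ⟨{.east, .west, .south, .north}, fun d => by cases d <;> simp⟩

variable {m n : ℕ}

theorem next_prev (i : Fin n) : next (prev i) = i := by
  apply Fin.ext
  have := i.isLt
  simp only [next, prev, Nat.mod_add_mod]
  rw [show i.val + (n - 1) + 1 = i.val + n by omega, Nat.add_mod_right, Nat.mod_eq_of_lt this]

theorem prev_next (i : Fin n) : prev (next i) = i := by
  apply Fin.ext
  have := i.isLt
  simp only [next, prev, Nat.mod_add_mod]
  rw [show i.val + 1 + (n - 1) = i.val + n by omega, Nat.add_mod_right, Nat.mod_eq_of_lt this]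

theorem val_next (i : Fin n) : (next i).val = if i.val + 1 = n then 0 else i.val + 1 := by
  have := i.isLt
  simp only [next]
  split_ifs with h
  · rw [h, Nat.mod_self]
  · exact Nat.mod_eq_of_lt (by omega)

theorem val_prev (i : Fin n) : (prev i).val = if i.val = 0 then n - 1 else i.val - 1 := by
  have := i.isLt
  simp only [prev]
  split_ifs with h
  · rw [h, zero_add]; exact Nat.mod_eq_of_lt (by omega)
  · rw [show i.val + (n - 1) = i.val - 1 + n by omega, Nat.add_mod_right]
    exact Nat.mod_eq_of_lt (by omega)

theorem next_ne (hn : 2 ≤ n) (i : Fin n) : next i ≠ i := by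
  intro h
  have := congrArg Fin.val h
  rw [val_next] at this
  split_ifs at this <;> omega

theorem prev_ne (hn : 2 ≤ n) (i : Fin n) : prev i ≠ i := by
  intro h
  have := congrArg next h
  rw [next_prev] at this
  exact next_ne hn i this.symm

/-- The opposite direction. -/
def Dir.opp : Dir → Dir
  | .east => .west
  | .west => .east
  | .south => .north
  | .north => .south

@[simp] theorem Dir.opp_opp (d : Dir) : d.opp.opp = d := by cases d <;> rfl

/-- The neighbour of a vertex in a given direction. -/
def step (u : Vertex m n) : Dir → Vertex m n
  | .east => (u.1, next u.2)
  | .west => (u.1, prev u.2)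
  | .south => (next u.1, u.2)
  | .north => (prev u.1, u.2)

/-- The edge leaving a vertex in a given direction. -/
def edgeAt (u : Vertex m n) : Dir → Edge m n
  | .east => .horizontal u.1 u.2
  | .west => .horizontal u.1 (prev u.2)
  | .south => .vertical u.1 u.2
  | .north => .vertical (prev u.1) u.2

@[simp] theorem step_step_opp (u : Vertex m n) (d : Dir) : step (step u d) d.opp = u := by
  cases d <;> simp [step, Dir.opp, next_prev, prev_next]

theorem edgeAt_step_opp (u : Vertex m n) (d : Dir) : edgeAt (step u d) d.opp = edgeAt u d := by
  cases d <;> simp [step, edgeAt, Dir.opp, prev_next]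

theorem mem_ends_iff (u : Vertex m n) (e : Edge m n) : u ∈ e.ends ↔ ∃ d, edgeAt u d = e := by
  obtain ⟨i, j⟩ := u
  constructor
  · intro h
    cases e with
    | horizontal a b =>
      simp only [Edge.ends, Sym2.mem_iff, Prod.mk.injEq] at h
      rcases h with ⟨rfl, rfl⟩ | ⟨rfl, rfl⟩
      · exact ⟨.east, rfl⟩
      · exact ⟨.west, by simp [edgeAt, prev_next]⟩
    | vertical a b =>
      simp only [Edge.ends, Sym2.mem_iff, Prod.mk.injEq] at h
      rcases h with ⟨rfl, rfl⟩ | ⟨rfl, rfl⟩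
      · exact ⟨.south, rfl⟩
      · exact ⟨.north, by simp [edgeAt, prev_next]⟩
  · rintro ⟨d, rfl⟩
    cases d <;> simp [edgeAt, Edge.ends, next_prev]

/-- Labelled edges are compared rather than pairs of end points, so the two parallel edges of a
cycle of length two remain distinct. -/
theorem edgeAt_eq_iff (u v : Vertex m n) (d d' : Dir) :
    edgeAt u d = edgeAt v d' ↔ (u = v ∧ d = d') ∨ (v = step u d ∧ d' = d.opp) := by
  constructor
  · obtain ⟨i, j⟩ := u
    obtain ⟨k, l⟩ := v
    cases d <;> cases d' <;> simp only [edgeAt, step, Dir.opp, Edge.horizontal.injEq,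
      Edge.vertical.injEq, reduceCtorEq, and_true, and_false, or_false, false_or, Prod.mk.injEq,
      false_imp_iff] <;> rintro ⟨h1, h2⟩
    · exact ⟨h1, h2⟩
    · subst h1 h2; simp [next_prev]
    · subst h1 h2; simp
    · subst h1; refine ⟨rfl, ?_⟩; simpa [next_prev] using congrArg next h2
    · exact ⟨h1, h2⟩
    · subst h1 h2; simp [next_prev]
    · subst h1 h2; simp
    · subst h2; refine ⟨?_, rfl⟩; simpa [next_prev] using congrArg next h1
  · rintro (⟨rfl, rfl⟩ | ⟨rfl, rfl⟩)
    · rfl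
    · exact (edgeAt_step_opp u d).symm

/-- In a cycle of length one, opposite directions would name the same loop; from length two on they
do not, even when they lead to the same neighbour. -/
theorem edgeAt_injective (hm : 2 ≤ m) (hn : 2 ≤ n) (u : Vertex m n) :
    Function.Injective (edgeAt u) := by
  intro d d' h
  rcases (edgeAt_eq_iff u u d d').1 h with h | ⟨h, -⟩
  · exact h.2
  · exfalso
    have h1 := congrArg Prod.fst h
    have h2 := congrArg Prod.snd h
    cases d <;> simp only [step] at h1 h2
    · exact next_ne hn _ h2.symm
    · exact prev_ne hn _ h2.symm
    · exact next_ne hm _ h1.symm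
    · exact prev_ne hm _ h1.symm

/-- A direction at every vertex such that neighbouring vertices point at each other in pairs. -/
def IsPairing (D : Vertex m n → Dir) : Prop :=
  ∀ u, D (step u (D u)) = (D u).opp

/-- The edges selected by a choice of directions. -/
def edgesOf (D : Vertex m n → Dir) : Finset (Edge m n) :=
  Finset.univ.image fun u => edgeAt u (D u)

theorem IsPairing.edgeAt_mem_iff {D : Vertex m n → Dir} (hD : IsPairing D) {u : Vertex m n}
    {d : Dir} : edgeAt u d ∈ edgesOf D ↔ D u = d := by
  simp only [edgesOf, Finset.mem_image, Finset.mem_univ, true_and]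
  constructor
  · rintro ⟨v, hv⟩
    rcases (edgeAt_eq_iff _ _ _ _).1 hv with ⟨rfl, h⟩ | ⟨rfl, h⟩
    · exact h
    · rw [hD, h]
  · rintro rfl
    exact ⟨u, rfl⟩

theorem IsPairing.isPerfectMatching {D : Vertex m n → Dir} (hD : IsPairing D) :
    IsPerfectMatching (edgesOf D) := by
  intro u
  refine ⟨edgeAt u (D u), ⟨hD.edgeAt_mem_iff.2 rfl, (mem_ends_iff _ _).2 ⟨_, rfl⟩⟩, ?_⟩
  rintro e ⟨he, hu⟩
  obtain ⟨d, rfl⟩ := (mem_ends_iff _ _).1 hu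
  rw [hD.edgeAt_mem_iff.1 he]

theorem exists_edgeAt_mem {M : Finset (Edge m n)} (hM : IsPerfectMatching M) (u : Vertex m n) :
    ∃ d, edgeAt u d ∈ M := by
  obtain ⟨e, ⟨he, hu⟩, -⟩ := hM u
  obtain ⟨d, rfl⟩ := (mem_ends_iff _ _).1 hu
  exact ⟨d, he⟩

/-- The direction of the edge chosen by a perfect matching at a vertex. -/
noncomputable def dirOf (M : PerfectMatching m n) (u : Vertex m n) : Dir :=
  (exists_edgeAt_mem M.2 u).choose

theorem edgeAt_mem_iff_dirOf (hm : 2 ≤ m) (hn : 2 ≤ n) (M : PerfectMatching m n)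
    (u : Vertex m n) (d : Dir) : edgeAt u d ∈ M.val ↔ dirOf M u = d := by
  have h0 : edgeAt u (dirOf M u) ∈ M.val := (exists_edgeAt_mem M.2 u).choose_spec
  constructor
  · intro h
    obtain ⟨e, -, he⟩ := M.2 u
    apply edgeAt_injective hm hn u
    rw [he _ ⟨h, (mem_ends_iff _ _).2 ⟨_, rfl⟩⟩, he _ ⟨h0, (mem_ends_iff _ _).2 ⟨_, rfl⟩⟩]
  · rintro rfl
    exact h0

theorem isPairing_dirOf (hm : 2 ≤ m) (hn : 2 ≤ n) (M : PerfectMatching m n) :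
    IsPairing (dirOf M) := by
  intro u
  rw [← edgeAt_mem_iff_dirOf hm hn, edgeAt_step_opp, edgeAt_mem_iff_dirOf hm hn]

theorem edgesOf_dirOf (hm : 2 ≤ m) (hn : 2 ≤ n) (M : PerfectMatching m n) :
    edgesOf (dirOf M) = M.val := by
  ext e
  have : ∃ u, ∃ d, edgeAt u d = e := by
    cases e with
    | horizontal i j => exact ⟨(i, j), .east, rfl⟩
    | vertical i j => exact ⟨(i, j), .south, rfl⟩
  obtain ⟨u, d, rfl⟩ := this
  rw [(isPairing_dirOf hm hn M).edgeAt_mem_iff, edgeAt_mem_iff_dirOf hm hn]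

theorem dirOf_edgesOf (hm : 2 ≤ m) (hn : 2 ≤ n) {D : Vertex m n → Dir} (hD : IsPairing D) :
    dirOf ⟨edgesOf D, hD.isPerfectMatching⟩ = D := by
  funext u
  rw [← edgeAt_mem_iff_dirOf hm hn]
  exact hD.edgeAt_mem_iff.2 rfl

/-! ### The chessboard colouring -/

/-- The vertices of one of the two colour classes of the chessboard colouring. -/
def IsWhite (u : Vertex m n) : Prop :=
  Even (u.1.val + u.2.val)

instance : DecidablePred (IsWhite (m := m) (n := n)) := fun u =>
  inferInstanceAs (Decidable (Even (u.1.val + u.2.val)))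

theorem even_val_next (hn : Even n) (i : Fin n) : Even (next i).val ↔ ¬ Even i.val := by
  have := i.isLt
  rw [val_next]
  split_ifs with h
  · have : Even (i.val + 1) := by rwa [h]
    rw [Nat.even_add_one] at this
    simp [this]
  · rw [Nat.even_add_one]

theorem even_val_prev (hn : Even n) (i : Fin n) : Even (prev i).val ↔ ¬ Even i.val := by
  have := even_val_next hn (prev i)
  rw [next_prev] at this
  tauto

theorem isWhite_step (hm : Even m) (hn : Even n) (u : Vertex m n) (d : Dir) :
    IsWhite (step u d) ↔ ¬ IsWhite u := by
  cases d <;> simp only [IsWhite, step, Nat.even_add, even_val_next hn, even_val_prev hn,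
    even_val_next hm, even_val_prev hm] <;> tauto

/-- Every edge has exactly one white end, also across the wrap, because both side lengths are even.
-/
theorem IsPairing.sum_edgesOf_white (hm : Even m) (hn : Even n) {D : Vertex m n → Dir}
    (hD : IsPairing D) {A : Type*} [AddCommMonoid A] (φ : Edge m n → A) :
    ∑ e ∈ edgesOf D, φ e = ∑ u with IsWhite u, φ (edgeAt u (D u)) := by
  symm
  refine Finset.sum_bij (fun u _ => edgeAt u (D u)) (fun u _ => hD.edgeAt_mem_iff.2 rfl) ?_ ?_
    (fun _ _ => rfl)
  · intro u hu v hv h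
    rcases (edgeAt_eq_iff _ _ _ _).1 h with ⟨h, -⟩ | ⟨h, -⟩
    · exact h
    · rw [Finset.mem_filter] at hu hv
      rw [h, isWhite_step hm hn] at hv
      exact absurd hu.2 hv.2
  · intro e he
    simp only [edgesOf, Finset.mem_image, Finset.mem_univ, true_and] at he
    obtain ⟨u, rfl⟩ := he
    by_cases hu : IsWhite u
    · exact ⟨u, by simpa using hu, rfl⟩
    · exact ⟨step u (D u), by simpa [isWhite_step hm hn] using hu,
        by rw [hD, edgeAt_step_opp]⟩

theorem IsPairing.sum_edgesOf_black (hm : Even m) (hn : Even n) {D : Vertex m n → Dir}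
    (hD : IsPairing D) {A : Type*} [AddCommMonoid A] (φ : Edge m n → A) :
    ∑ e ∈ edgesOf D, φ e = ∑ u with ¬ IsWhite u, φ (edgeAt u (D u)) := by
  rw [hD.sum_edgesOf_white hm hn]
  refine Finset.sum_bij' (fun u _ => step u (D u)) (fun u _ => step u (D u)) ?_ ?_ ?_ ?_ ?_
  · intro u hu; simpa [isWhite_step hm hn] using hu
  · intro u hu; simpa [isWhite_step hm hn] using hu
  · intro u _; rw [hD, step_step_opp]
  · intro u _; rw [hD, step_step_opp]
  · intro u _; rw [hD, edgeAt_step_opp]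

/-! ### Eventually periodic orbits and the permutation of their cycle -/

section Rho

variable {α : Type*} {f : α → α} {x : α} {t K : ℕ}

/-- The orbit of `x` under `f` repeats for the first time at time `K`, when it returns to its
position at time `t`. -/
structure IsRho (f : α → α) (x : α) (t K : ℕ) : Prop where
  lt : t < K
  eq : f^[K] x = f^[t] x
  inj : ∀ a < K, ∀ b < K, f^[a] x = f^[b] x → a = b

theorem exists_isRho [Finite α] (f : α → α) (x : α) : ∃ t K, IsRho f x t K := by
  have h : ∃ K, ∃ t < K, f^[K] x = f^[t] x := by
    obtain ⟨a, b, hab, h⟩ := Finite.exists_ne_map_eq_of_infinite fun k : ℕ => f^[k] x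
    rcases lt_or_gt_of_ne hab with hlt | hlt
    · exact ⟨b, a, hlt, h.symm⟩
    · exact ⟨a, b, hlt, h⟩
  classical
  obtain ⟨t, ht, he⟩ := Nat.find_spec h
  refine ⟨t, Nat.find h, ht, he, fun a ha b hb hab => ?_⟩
  by_contra hne
  rcases lt_or_gt_of_ne hne with hlt | hlt
  · exact Nat.find_min h hb ⟨a, hlt, hab.symm⟩
  · exact Nat.find_min h ha ⟨b, hlt, hab⟩

/-- `shiftCycle` obtains the two times by choice; uniqueness allows any other pair of times with the
same property in their place. -/
theorem IsRho.unique {t' K' : ℕ} (h : IsRho f x t K) (h' : IsRho f x t' K') :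
    t = t' ∧ K = K' := by
  have hK : K = K' := by
    rcases lt_trichotomy K K' with hlt | he | hlt
    · have := h'.inj _ hlt _ (h.lt.trans hlt) h.eq
      have := h.lt
      omega
    · exact he
    · have := h.inj _ hlt _ (h'.lt.trans hlt) h'.eq
      have := h'.lt
      omega
  subst hK
  exact ⟨h.inj _ h.lt _ h'.lt (h.eq.symm.trans h'.eq), rfl⟩

theorem IsRho.le_card [Fintype α] (h : IsRho f x t K) : K ≤ Fintype.card α := by
  have : Function.Injective fun a : Fin K => f^[a.val] x := fun a b hab =>
    Fin.ext (h.inj _ a.isLt _ b.isLt hab)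
  simpa using Fintype.card_le_of_injective _ this

/-- The cycle into which an orbit runs, as a list. -/
def cycleList (f : α → α) (x : α) (t K : ℕ) : List α :=
  (List.range (K - t)).map fun s => f^[t + s] x

theorem mem_cycleList {y : α} : y ∈ cycleList f x t K ↔ ∃ s, t ≤ s ∧ s < K ∧ f^[s] x = y := by
  simp only [cycleList, List.mem_map, List.mem_range]
  constructor
  · rintro ⟨s, hs, rfl⟩
    exact ⟨t + s, by omega, by omega, rfl⟩
  · rintro ⟨s, h1, h2, rfl⟩
    exact ⟨s - t, by omega, by rw [Nat.add_sub_cancel' h1]⟩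

theorem length_cycleList : (cycleList f x t K).length = K - t := by
  simp [cycleList]

theorem IsRho.nodup_cycleList (h : IsRho f x t K) : (cycleList f x t K).Nodup := by
  refine (List.nodup_map_iff_inj_on List.nodup_range).2 fun a ha b hb hab => ?_
  rw [List.mem_range] at ha hb
  have := h.inj _ (by omega) _ (by omega) hab
  omega

variable [DecidableEq α]

/-- The permutation that agrees with `f` on the cycle and fixes all other points. -/
def cyclePerm (f : α → α) (x : α) (t K : ℕ) : Equiv.Perm α :=
  (cycleList f x t K).formPerm

theorem cyclePerm_of_notMem {y : α} (h : y ∉ cycleList f x t K) : cyclePerm f x t K y = y :=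
  List.formPerm_apply_of_notMem h

theorem IsRho.cyclePerm_apply (h : IsRho f x t K) {y : α} (hy : y ∈ cycleList f x t K) :
    cyclePerm f x t K y = f y := by
  obtain ⟨s, h1, h2, rfl⟩ := mem_cycleList.1 hy
  have hlen : s - t < (cycleList f x t K).length := by rw [length_cycleList]; omega
  have key := List.formPerm_apply_getElem (cycleList f x t K) h.nodup_cycleList (s - t) hlen
  have hget : ∀ k (hk : k < (cycleList f x t K).length), (cycleList f x t K)[k] = f^[t + k] x := by
    intro k hk
    simp [cycleList]
  rw [hget, hget, length_cycleList, Nat.add_sub_cancel' h1] at key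
  rw [cyclePerm, key, ← Function.iterate_succ_apply' f]
  rcases Nat.lt_or_ge (s + 1) K with h3 | h3
  · rw [Nat.mod_eq_of_lt (by omega)]
    congr 2
    omega
  · have h4 : s - t + 1 = K - t := by omega
    rw [h4, Nat.mod_self, Nat.add_zero, ← h.eq]
    congr 2
    omega

theorem IsRho.sign_cyclePerm [Fintype α] (h : IsRho f x t K) :
    Equiv.Perm.sign (cyclePerm f x t K) = -(-1) ^ (K - t) := by
  have hlt := h.lt
  rcases Nat.lt_or_ge 1 (K - t) with h1 | h1
  · rw [cyclePerm, (List.isCycle_formPerm h.nodup_cycleList (by rw [length_cycleList]; omega)).sign,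
      List.support_formPerm_of_nodup _ h.nodup_cycleList, List.toFinset_card_of_nodup
      h.nodup_cycleList, length_cycleList]
    intro y hy
    have := congrArg List.length hy
    rw [length_cycleList, List.length_singleton] at this
    omega
  -- A cycle of length one is possible: in a grid cycle of length two, two steps straight on lead
  -- back. The permutation is then the identity, and the formula still holds.
  · have h2 : K - t = 1 := by omega
    rw [cyclePerm, cycleList, h2]
    simp

end Rho

/-! ### Shifting a pairing along a cycle of the walk -/

/-- The vertex reached from `u` by walking along the edge chosen at `u` and one step further in
the same direction. -/
def advance (D : Vertex m n → Dir) (u : Vertex m n) : Vertex m n :=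
  step (step u (D u)) (D u)

theorem isWhite_advance (hm : Even m) (hn : Even n) (D : Vertex m n → Dir) (u : Vertex m n) :
    IsWhite (advance D u) ↔ IsWhite u := by
  rw [advance, isWhite_step hm hn, isWhite_step hm hn, not_not]

theorem isWhite_iterate_advance (hm : Even m) (hn : Even n) (D : Vertex m n → Dir)
    (u : Vertex m n) (s : ℕ) : IsWhite ((advance D)^[s] u) ↔ IsWhite u := by
  induction s with
  | zero => rfl
  | succ s ih => rw [Function.iterate_succ_apply', isWhite_advance hm hn, ih]

/-- Shift the chosen edges along a cycle of vertices, where `c` is the shift and `C` the set of the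
vertices on the cycle. -/
def shift (D : Vertex m n → Dir) (C : List (Vertex m n)) (c : Equiv.Perm (Vertex m n))
    (u : Vertex m n) : Dir :=
  if u ∈ C then (D (c⁻¹ u)).opp else if step u (D u) ∈ C then (D u).opp else D u

/-- `C` consists of white vertices, and `c` agrees with `advance D` on `C` and fixes all other
vertices. -/
structure IsShift (D : Vertex m n → Dir) (C : List (Vertex m n))
    (c : Equiv.Perm (Vertex m n)) : Prop where
  white : ∀ u ∈ C, IsWhite u
  apply_of_mem : ∀ u ∈ C, c u = advance D u
  apply_of_notMem : ∀ u ∉ C, c u = u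

namespace IsShift

variable {D : Vertex m n → Dir} {C : List (Vertex m n)} {c : Equiv.Perm (Vertex m n)}

theorem apply_mem_iff (h : IsShift D C c) (u : Vertex m n) : c u ∈ C ↔ u ∈ C := by
  constructor
  · intro hu
    by_contra hn
    rw [h.apply_of_notMem u hn] at hu
    exact hn hu
  · intro hu
    by_contra hn
    have := c.injective (h.apply_of_notMem _ hn)
    rw [this] at hn
    exact hn hu

theorem inv_mem_iff (h : IsShift D C c) (u : Vertex m n) : c⁻¹ u ∈ C ↔ u ∈ C := by
  have := h.apply_mem_iff (c⁻¹ u)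
  rw [show c (c⁻¹ u) = u from c.apply_symm_apply u] at this
  exact this.symm

theorem shift_apply_white {u : Vertex m n} (hu : u ∈ C) :
    shift D C c u = (D (c⁻¹ u)).opp := by
  rw [shift, if_pos hu]

theorem shift_apply_cycle (h : IsShift D C c) {u : Vertex m n} (hu : u ∈ C) :
    shift D C c (c u) = (D u).opp := by
  rw [shift_apply_white ((h.apply_mem_iff u).2 hu), show c⁻¹ (c u) = u from c.symm_apply_apply u]

theorem shift_apply_partner (hm : Even m) (hn : Even n) (hD : IsPairing D) (h : IsShift D C c)
    {u : Vertex m n} (hu : u ∈ C) : shift D C c (step u (D u)) = D u := by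
  rw [shift, if_neg, hD, step_step_opp, if_pos hu, Dir.opp_opp]
  intro hC
  exact (isWhite_step hm hn _ _).1 (h.white _ hC) (h.white _ hu)

theorem shift_apply_other (D : Vertex m n → Dir) (C : List (Vertex m n))
    (c : Equiv.Perm (Vertex m n)) {u : Vertex m n} (hu : u ∉ C) (hu' : step u (D u) ∉ C) :
    shift D C c u = D u := by
  rw [shift, if_neg hu, if_neg hu']

theorem shift_apply_white_of_notMem (hm : Even m) (hn : Even n) (h : IsShift D C c)
    {u : Vertex m n} (hw : IsWhite u) (hu : u ∉ C) : shift D C c u = D u := by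
  refine shift_apply_other D C c hu fun hC => ?_
  exact (isWhite_step hm hn _ _).1 (h.white _ hC) hw

/-- A vertex of the cycle lies one step beyond the old partner of its predecessor, so the reversed
direction leads back to that partner. -/
theorem step_shift (h : IsShift D C c) {u : Vertex m n} (hu : u ∈ C) :
    step u (shift D C c u) = step (c⁻¹ u) (D (c⁻¹ u)) := by
  have hv := (h.inv_mem_iff u).2 hu
  have h1 := h.apply_of_mem _ hv
  rw [show c (c⁻¹ u) = u from c.apply_symm_apply u] at h1
  rw [shift_apply_white hu]
  generalize c⁻¹ u = v at h1
  rw [h1, advance, step_step_opp]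

theorem isPairing_shift (hm : Even m) (hn : Even n) (hD : IsPairing D) (h : IsShift D C c) :
    IsPairing (shift D C c) := by
  intro u
  by_cases hu : u ∈ C
  · have hv := (h.inv_mem_iff u).2 hu
    rw [h.step_shift hu, h.shift_apply_partner hm hn hD hv, shift_apply_white hu, Dir.opp_opp]
  by_cases hu' : step u (D u) ∈ C
  · have hs : shift D C c u = (D u).opp := by rw [shift, if_neg hu, if_pos hu']
    have h1 : step u (D u).opp = c (step u (D u)) := by
      rw [h.apply_of_mem _ hu', advance, hD, step_step_opp]
    rw [hs, h1, h.shift_apply_cycle hu', hD]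
  · rw [shift_apply_other D C c hu hu']
    by_cases hw : IsWhite u
    · rw [shift_apply_other, hD]
      · intro hC
        exact (isWhite_step hm hn _ _).1 (h.white _ hC) hw
      · rwa [hD, step_step_opp]
    · rw [h.shift_apply_white_of_notMem hm hn ((isWhite_step hm hn _ _).2 hw) hu', hD]

/-- Two steps in the reversed direction undo the two steps that led from the predecessor to this
vertex: the shift reverses the sense of the cycle. -/
theorem advance_shift_of_mem (h : IsShift D C c) {u : Vertex m n} (hu : u ∈ C) :
    advance (shift D C c) u = c⁻¹ u := by
  rw [advance, h.step_shift hu, shift_apply_white hu, step_step_opp]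

theorem advance_shift_of_notMem (hm : Even m) (hn : Even n) (h : IsShift D C c) {u : Vertex m n}
    (hw : IsWhite u) (hu : u ∉ C) : advance (shift D C c) u = advance D u := by
  rw [advance, h.shift_apply_white_of_notMem hm hn hw hu, advance]

theorem shift_shift (hD : IsPairing D) (h : IsShift D C c) :
    shift (shift D C c) C c⁻¹ = D := by
  funext u
  by_cases hu : u ∈ C
  · rw [shift, if_pos hu, inv_inv, h.shift_apply_cycle hu, Dir.opp_opp]
  by_cases hu' : step u (D u) ∈ C
  · have hs : shift D C c u = (D u).opp := by rw [shift, if_neg hu, if_pos hu']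
    rw [shift, if_neg hu, hs, Dir.opp_opp, if_pos]
    have h1 : step u (D u).opp = c (step u (D u)) := by
      rw [h.apply_of_mem _ hu', advance, hD, step_step_opp]
    rw [h1]
    exact (h.apply_mem_iff _).2 hu'
  · rw [shift, if_neg hu, shift_apply_other D C c hu hu', if_neg hu']

end IsShift

/-! ### The shift along the cycle reached from a vertex is an involution -/

/-- The white corner of the grid. -/
def corner (hm : 0 < m) (hn : 0 < n) : Vertex m n := (⟨0, hm⟩, ⟨0, hn⟩)

theorem isWhite_corner (hm : 0 < m) (hn : 0 < n) : IsWhite (corner hm hn) := by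
  simp [IsWhite, corner]

theorem isShift_cycle (hm : Even m) (hn : Even n) {w : Vertex m n} (hw : IsWhite w)
    {D : Vertex m n → Dir} {t K : ℕ} (h : IsRho (advance D) w t K) :
    IsShift D (cycleList (advance D) w t K) (cyclePerm (advance D) w t K) where
  white := by
    intro u hu
    obtain ⟨s, -, -, rfl⟩ := mem_cycleList.1 hu
    exact (isWhite_iterate_advance hm hn D w s).2 hw
  apply_of_mem := fun u hu => h.cyclePerm_apply hu
  apply_of_notMem := fun u hu => cyclePerm_of_notMem hu

theorem shift_congr {D : Vertex m n → Dir} {C C' : List (Vertex m n)}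
    {c : Equiv.Perm (Vertex m n)} (h : ∀ u, u ∈ C ↔ u ∈ C') : shift D C c = shift D C' c := by
  funext u
  simp only [shift, h]

/-- The walk from `w` runs into a cycle; shift the chosen edges along that cycle. -/
noncomputable def shiftCycle (D : Vertex m n → Dir) (w : Vertex m n) : Vertex m n → Dir :=
  let t := (exists_isRho (advance D) w).choose
  let K := (exists_isRho (advance D) w).choose_spec.choose
  shift D (cycleList (advance D) w t K) (cyclePerm (advance D) w t K)

theorem shiftCycle_eq {D : Vertex m n → Dir} {w : Vertex m n} {t K : ℕ}
    (h : IsRho (advance D) w t K) :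
    shiftCycle D w = shift D (cycleList (advance D) w t K) (cyclePerm (advance D) w t K) := by
  obtain ⟨h1, h2⟩ := h.unique (exists_isRho (advance D) w).choose_spec.choose_spec
  simp only [shiftCycle, ← h2]
  congr 1 <;> simp only [← h1]

theorem isPairing_shiftCycle (hm : Even m) (hn : Even n) {w : Vertex m n} (hw : IsWhite w)
    {D : Vertex m n → Dir} (hD : IsPairing D) : IsPairing (shiftCycle D w) := by
  obtain ⟨t, K, h⟩ := exists_isRho (advance D) w
  rw [shiftCycle_eq h]
  exact (isShift_cycle hm hn hw h).isPairing_shift hm hn hD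

theorem shiftCycle_shiftCycle (hm : Even m) (hn : Even n) {w : Vertex m n} (hw : IsWhite w)
    {D : Vertex m n → Dir} (hD : IsPairing D) : shiftCycle (shiftCycle D w) w = D := by
  obtain ⟨t, K, h⟩ := exists_isRho (advance D) w
  have hs := isShift_cycle hm hn hw h
  have hlt := h.lt
  rw [shiftCycle_eq h]
  set C := cycleList (advance D) w t K with hC
  set c := cyclePerm (advance D) w t K with hc
  have hmem : ∀ s, t ≤ s → s < K → (advance D)^[s] w ∈ C := fun s h1 h2 =>
    mem_cycleList.2 ⟨s, h1, h2, rfl⟩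
  have hnot : ∀ s < t, (advance D)^[s] w ∉ C := by
    intro s h1 hmem
    obtain ⟨a, h2, h3, h4⟩ := mem_cycleList.1 hmem
    have := h.inj _ h3 _ (by omega) h4
    omega
  have hinv : ∀ s, t ≤ s → s < K → c⁻¹ ((advance D)^[s + 1] w) = (advance D)^[s] w := by
    intro s h1 h2
    rw [Equiv.Perm.inv_eq_iff_eq, hs.apply_of_mem _ (hmem s h1 h2),
      Function.iterate_succ_apply']
  -- White vertices outside the cycle keep their directions, so the tail is walked as before.
  have tail : ∀ s ≤ t, (advance (shift D C c))^[s] w = (advance D)^[s] w := by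
    intro s hst
    induction s with
    | zero => rfl
    | succ s ih =>
      rw [Function.iterate_succ_apply', ih (by omega), hs.advance_shift_of_notMem hm hn
        ((isWhite_iterate_advance hm hn D w s).2 hw) (hnot s (by omega)),
        Function.iterate_succ_apply']
  have back : ∀ r, t + r ≤ K →
      (advance (shift D C c))^[t + r] w = (advance D)^[K - r] w := by
    intro r hr
    induction r with
    | zero => rw [Nat.add_zero, tail t le_rfl, Nat.sub_zero, h.eq]
    | succ r ih =>
      rw [← Nat.add_assoc, Function.iterate_succ_apply', ih (by omega),
        hs.advance_shift_of_mem]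
      · have := hinv (K - (r + 1)) (by omega) (by omega)
        rwa [show K - (r + 1) + 1 = K - r by omega] at this
      · rcases Nat.eq_zero_or_pos r with rfl | h0
        · rw [Nat.sub_zero, h.eq]
          exact hmem t le_rfl h.lt
        · exact hmem _ (by omega) (by omega)
  -- The new orbit is the old one with the times on the cycle reflected by $s \mapsto K+t-s$, where
  -- time $t$ itself stays fixed. Hence it first repeats at the same time and has the same cycle as
  -- a set.
  have orbit : ∀ s < K, ∃ a < K, (t ≤ s ↔ t ≤ a) ∧ a = (if s ≤ t then s else K + t - s) ∧
      (advance (shift D C c))^[s] w = (advance D)^[a] w := by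
    intro s hsK
    by_cases hst : s ≤ t
    · exact ⟨s, hsK, Iff.rfl, by rw [if_pos hst], tail s hst⟩
    · refine ⟨K + t - s, by omega, by omega, by rw [if_neg hst], ?_⟩
      have := back (s - t) (by omega)
      rw [show t + (s - t) = s by omega, show K - (s - t) = K + t - s by omega] at this
      exact this
  have h' : IsRho (advance (shift D C c)) w t K := by
    refine ⟨h.lt, ?_, ?_⟩
    · have := back (K - t) (by omega)
      rw [show t + (K - t) = K by omega, show K - (K - t) = t by omega] at this
      rw [this, tail t le_rfl]
    · intro a ha b hb hab
      obtain ⟨a', h1, -, h2, h3⟩ := orbit a ha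
      obtain ⟨b', h4, -, h5, h6⟩ := orbit b hb
      rw [h3, h6] at hab
      have := h.inj _ h1 _ h4 hab
      split_ifs at h2 h5 <;> omega
  have hC' : ∀ u, u ∈ cycleList (advance (shift D C c)) w t K ↔ u ∈ C := by
    intro u
    rw [hC, mem_cycleList, mem_cycleList]
    constructor
    · rintro ⟨s, h1, h2, rfl⟩
      obtain ⟨a, h3, h4, -, h5⟩ := orbit s h2
      exact ⟨a, h4.1 h1, h3, h5.symm⟩
    · rintro ⟨s, h1, h2, rfl⟩
      rcases Nat.eq_or_lt_of_le h1 with rfl | h3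
      · exact ⟨t, le_rfl, h2, tail t le_rfl⟩
      · refine ⟨t + (K - s), by omega, by omega, ?_⟩
        rw [back _ (by omega), show K - (K - s) = s by omega]
  have hs' := isShift_cycle hm hn hw h'
  have hc' : cyclePerm (advance (shift D C c)) w t K = c⁻¹ := by
    ext1 u
    by_cases hu : u ∈ C
    · rw [hs'.apply_of_mem u ((hC' u).2 hu), hs.advance_shift_of_mem hu]
    · rw [hs'.apply_of_notMem u (fun hu' => hu ((hC' u).1 hu')), eq_comm,
        Equiv.Perm.inv_eq_iff_eq, hs.apply_of_notMem u hu]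
  rw [shiftCycle_eq h', hc', shift_congr hC', hs.shift_shift hD]

/-! ### Chord crossings under a permutation of the partners -/

section SignProducts

variable {N : ℕ}

theorem prod_Ioi_mul_prod_diag {R : Type*} [CommMonoid R] (F : Fin N → Fin N → R) :
    (∏ i, ∏ j ∈ Finset.Ioi i, F j i * F i j) * ∏ i, F i i = ∏ i, ∏ j, F j i := by
  rw [Finset.prod_prod_Ioi_mul_eq_prod_prod_off_diag, ← Finset.prod_mul_distrib]
  refine Finset.prod_congr rfl fun i _ => ?_
  rw [mul_comm, ← Finset.prod_singleton (fun j => F j i) i, Finset.prod_mul_prod_compl]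

variable {V : Type*} (s : V → V → ℤ)

/-- The product of the signs of the four pairs formed by an end of the chord from `a` to `b` and an
end of the chord from `a'` to `b'`. -/
def chordSign (a b a' b' : V) : ℤ :=
  s a a' * s b b' * (s a b' * s b a')

theorem chordSign_symm (hs : ∀ a b, s a b = -s b a) (a b a' b' : V) :
    chordSign s a' b' a b = chordSign s a b a' b' := by
  simp only [chordSign]
  rw [hs a' a, hs b' b, hs a' b, hs b' a]
  ring

theorem chordSign_swap_left (a b a' b' : V) : chordSign s b a a' b' = chordSign s a b a' b' := by
  simp only [chordSign]
  ring

theorem chordSign_swap_right (a b a' b' : V) : chordSign s a b b' a' = chordSign s a b a' b' := by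
  simp only [chordSign]
  ring

/-- The mixed factors of the pairs $i<j$, together with the diagonal ones, fill up the product over
all white-black pairs, up to a sign that depends only on $N$. This isolates the product over pairs
of `b` as the only part sensitive to the order of `b`. -/
theorem prod_chordSign_mul (hs : ∀ a b, s a b = -s b a) (w b : Fin N → V) :
    (∏ i, ∏ j ∈ Finset.Ioi i, chordSign s (w i) (b i) (w j) (b j)) * ∏ i, s (w i) (b i) =
      (∏ i, ∏ j ∈ Finset.Ioi i, s (w i) (w j)) * (∏ i, ∏ j ∈ Finset.Ioi i, s (b i) (b j)) *
        ((∏ i : Fin N, ∏ _j ∈ Finset.Ioi i, (-1)) * ∏ i, ∏ j, s (w j) (b i)) := by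
  rw [← prod_Ioi_mul_prod_diag fun i j => s (w i) (b j)]
  have : ∀ i j, chordSign s (w i) (b i) (w j) (b j) = s (w i) (w j) * s (b i) (b j) *
      ((-1) * (s (w j) (b i) * s (w i) (b j))) := by
    intro i j
    rw [chordSign, hs (b i) (w j)]
    ring
  simp only [this, Finset.prod_mul_distrib]
  ring

/-- Under a permutation of `b` the product over all white-black pairs is invariant, and the
antisymmetric product over pairs of `b` changes by the sign of the permutation. -/
theorem prod_chordSign_comp (hs : ∀ a b, s a b = -s b a) (w b : Fin N → V)
    (σ : Equiv.Perm (Fin N)) :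
    (∏ i, ∏ j ∈ Finset.Ioi i, chordSign s (w i) (b (σ i)) (w j) (b (σ j))) *
        ∏ i, s (w i) (b (σ i)) =
      Equiv.Perm.sign σ * ((∏ i, ∏ j ∈ Finset.Ioi i, chordSign s (w i) (b i) (w j) (b j)) *
        ∏ i, s (w i) (b i)) := by
  rw [prod_chordSign_mul s hs w (fun i => b (σ i)), prod_chordSign_mul s hs w b,
    σ.prod_Ioi_comp_eq_sign_mul_prod (f := fun i j => s (b i) (b j)) fun i j => hs _ _,
    Equiv.prod_comp σ fun i => ∏ j, s (w j) (b i)]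
  simp only [Int.cast_id]
  ring

end SignProducts

/-! ### Crossings of grid edges in the lexicographic order -/

/-- The sign of the lexicographic comparison of two vertices. -/
def lexSign (u v : Vertex m n) : ℤ :=
  if u.1.val < v.1.val then 1 else if v.1.val < u.1.val then -1 else
    if u.2.val < v.2.val then 1 else if v.2.val < u.2.val then -1 else 0

theorem lexSign_antisymm (u v : Vertex m n) : lexSign u v = -lexSign v u := by
  simp only [lexSign]
  split_ifs <;> omega

/-- The sign of a direction: positive for those pointing to a later vertex. -/
def Dir.sgn : Dir → ℤ
  | .east => 1
  | .west => -1
  | .south => 1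
  | .north => -1

theorem Dir.sgn_opp (d : Dir) : d.opp.sgn = -d.sgn := by cases d <;> rfl

/-- Whether an edge joins the last column to the first, or the last row to the first. -/
def Edge.IsWrap : Edge m n → Prop
  | .horizontal _ j => j.val + 1 = n
  | .vertical i _ => i.val + 1 = m

instance : DecidablePred (Edge.IsWrap (m := m) (n := n))
  | .horizontal _ j => inferInstanceAs (Decidable (j.val + 1 = n))
  | .vertical i _ => inferInstanceAs (Decidable (i.val + 1 = m))

theorem lexSign_step (hm : 2 ≤ m) (hn : 2 ≤ n) (u : Vertex m n) (d : Dir) :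
    lexSign u (step u d) = d.sgn * (-1) ^ (if (edgeAt u d).IsWrap then 1 else 0) := by
  obtain ⟨⟨i, hi⟩, ⟨j, hj⟩⟩ := u
  cases d <;> simp only [lexSign, step, edgeAt, Edge.IsWrap, Dir.sgn, val_next, val_prev] <;>
    split_ifs <;> first | omega | simp [*]

/-- The ordered contribution of two edges to the number of crossings of their chords. -/
def crossing : Edge m n → Edge m n → ℕ
  | .vertical i j, .vertical i' j' => if j'.val < j.val ∧ (i' = i ∨ i' = next i) then 1 else 0
  | .horizontal i j, .vertical i' _ => if j.val + 1 = n ∧ (i' = i ∨ next i' = i) then 1 else 0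
  | _, .horizontal _ _ => 0

theorem crossing_self (e : Edge m n) : crossing e e = 0 := by
  cases e <;> simp [crossing]

theorem next_injective : Function.Injective (next : Fin n → Fin n) :=
  Function.LeftInverse.injective prev_next

/-- The product is −1 exactly if `v` lies between the two ends. Ends in consecutive columns have
nothing between them; the ends of a wrapping edge enclose the rest of their row. -/
theorem lexSign_mul_east (i : Fin m) (j : Fin n) (v : Vertex m n) (h : (i, j) ≠ v)
    (h' : (i, next j) ≠ v) : lexSign (i, j) v * lexSign (i, next j) v =
      if j.val + 1 = n ∧ v.1 = i then -1 else 1 := by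
  obtain ⟨r, c⟩ := v
  simp only [ne_eq, Prod.mk.injEq, Fin.ext_iff, val_next] at h h'
  have := j.isLt
  have := c.isLt
  simp only [lexSign, val_next, Fin.ext_iff]
  rcases lt_trichotomy i.val r.val with h0 | h0 | h0
  · simp [h0, h0.ne']
  · simp only [h0, lt_irrefl, if_false, and_true, true_and] at h h' ⊢
    split_ifs at h' ⊢ <;> omega
  · simp [h0, h0.not_gt, h0.ne]

/-- Between the ends of a vertical edge lie the rest of the upper row after column `j` and the part
of the lower row before it. For a wrapping edge these are the vertices outside, whence the
additional sign. -/
theorem lexSign_mul_south (hm : 2 ≤ m) (i : Fin m) (j : Fin n) (v : Vertex m n) (h : (i, j) ≠ v)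
    (h' : (next i, j) ≠ v) : lexSign (i, j) v * lexSign (next i, j) v =
      (if i.val + 1 = m then -1 else 1) *
        if (v.1 = i ∧ j.val < v.2.val) ∨ (v.1 = next i ∧ v.2.val < j.val) then -1 else 1 := by
  obtain ⟨r, c⟩ := v
  simp only [ne_eq, Prod.mk.injEq, Fin.ext_iff, val_next] at h h'
  have := i.isLt
  have := r.isLt
  simp only [lexSign, val_next, Fin.ext_iff]
  by_cases hw : i.val + 1 = m
  · simp only [hw, if_true] at h' ⊢
    split_ifs <;> omega
  · simp only [hw, if_false] at h' ⊢
    split_ifs <;> omega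

theorem chordSign_east_east (i i' : Fin m) (j j' : Fin n)
    (h1 : (i, j) ≠ (i', j')) (h2 : (i, j) ≠ (i', next j')) (h3 : (i, next j) ≠ (i', j'))
    (h4 : (i, next j) ≠ (i', next j')) :
    chordSign lexSign (i, j) (i, next j) (i', j') (i', next j') = 1 := by
  have : chordSign lexSign (i, j) (i, next j) (i', j') (i', next j') =
      lexSign (i, j) (i', j') * lexSign (i, next j) (i', j') *
        (lexSign (i, j) (i', next j') * lexSign (i, next j) (i', next j')) := by
    simp only [chordSign]
    ring
  rw [this, lexSign_mul_east _ _ _ h1 h3, lexSign_mul_east _ _ _ h2 h4]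
  split_ifs <;> rfl

theorem chordSign_east_south (hm : 2 ≤ m) (i i' : Fin m) (j j' : Fin n)
    (h1 : (i, j) ≠ (i', j')) (h2 : (i, j) ≠ (next i', j')) (h3 : (i, next j) ≠ (i', j'))
    (h4 : (i, next j) ≠ (next i', j')) :
    chordSign lexSign (i, j) (i, next j) (i', j') (next i', j') =
      (-1) ^ (if j.val + 1 = n ∧ (i' = i ∨ next i' = i) then 1 else 0) := by
  have : chordSign lexSign (i, j) (i, next j) (i', j') (next i', j') =
      lexSign (i, j) (i', j') * lexSign (i, next j) (i', j') *
        (lexSign (i, j) (next i', j') * lexSign (i, next j) (next i', j')) := by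
    simp only [chordSign]
    ring
  rw [this, lexSign_mul_east _ _ _ h1 h3, lexSign_mul_east _ _ _ h2 h4]
  by_cases ha : j.val + 1 = n <;> by_cases hb : i' = i
  · subst hb
    simp [ha, next_ne hm]
  · by_cases hc : next i' = i <;> simp [ha, hb, hc]
  · simp [ha]
  · simp [ha]

theorem chordSign_south_south (hm : 2 ≤ m) (i i' : Fin m) (j j' : Fin n)
    (h1 : (i, j) ≠ (i', j')) (h2 : (i, j) ≠ (next i', j')) (h3 : (next i, j) ≠ (i', j'))
    (h4 : (next i, j) ≠ (next i', j')) :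
    chordSign lexSign (i, j) (next i, j) (i', j') (next i', j') =
      (-1) ^ ((if j'.val < j.val ∧ (i' = i ∨ i' = next i) then 1 else 0) +
        if j.val < j'.val ∧ (i = i' ∨ i = next i') then 1 else 0) := by
  have : chordSign lexSign (i, j) (next i, j) (i', j') (next i', j') =
      lexSign (i, j) (i', j') * lexSign (next i, j) (i', j') *
        (lexSign (i, j) (next i', j') * lexSign (next i, j) (next i', j')) := by
    simp only [chordSign]
    ring
  rw [this, lexSign_mul_south hm _ _ _ h1 h3, lexSign_mul_south hm _ _ _ h2 h4]
  -- Both ends of the second edge are compared with the first one, so the sign from wrapping occurs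
  -- twice and cancels.
  have hsq : (if i.val + 1 = m then -1 else 1 : ℤ) * (if i.val + 1 = m then -1 else 1) = 1 := by
    split_ifs <;> rfl
  rw [mul_mul_mul_comm, hsq, one_mul]
  have hnext : next i' = next i ↔ i' = i := next_injective.eq_iff
  simp only [hnext, eq_comm (a := i) (b := i'), eq_comm (a := i) (b := next i')]
  rcases lt_trichotomy j.val j'.val with hj | hj | hj
  · by_cases ha : i' = i
    · subst ha
      simp [hj, hj.not_gt, next_ne hm]
    · by_cases hb : next i' = i <;> simp [hj, hj.not_gt, ha, hb]
  · have := Fin.ext hj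
    simp [hj]
  · by_cases ha : i' = i
    · subst ha
      simp [hj, hj.not_gt, (next_ne hm _).symm]
    · by_cases hb : i' = next i
      · simp [hj, hj.not_gt, hb, next_ne hm]
      · simp [hj, hj.not_gt, ha, hb]

/-- The parity of the number of crossings of the chords of two disjoint edges. -/
theorem chordSign_eq_crossing (hm : 2 ≤ m) {u v : Vertex m n} {d d' : Dir}
    (h1 : u ≠ v) (h2 : u ≠ step v d') (h3 : step u d ≠ v) (h4 : step u d ≠ step v d') :
    chordSign lexSign u (step u d) v (step v d') =
      (-1) ^ (crossing (edgeAt u d) (edgeAt v d') + crossing (edgeAt v d') (edgeAt u d)) := by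
  -- The chord sign does not depend on the order of the two ends of a chord, so each edge may be
  -- read from the end where it points east or south.
  have main : ∀ (u v : Vertex m n) (d d' : Dir), (d = .east ∨ d = .south) →
      (d' = .east ∨ d' = .south) → u ≠ v → u ≠ step v d' → step u d ≠ v →
      step u d ≠ step v d' → chordSign lexSign u (step u d) v (step v d') =
      (-1) ^ (crossing (edgeAt u d) (edgeAt v d') + crossing (edgeAt v d') (edgeAt u d)) := by
    rintro ⟨i, j⟩ ⟨i', j'⟩ d d' (rfl | rfl) (rfl | rfl) h1 h2 h3 h4
    · rw [show step (i, j) .east = (i, next j) from rfl,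
        show step (i', j') .east = (i', next j') from rfl, chordSign_east_east _ _ _ _ h1 h2 h3 h4]
      rfl
    · exact chordSign_east_south hm _ _ _ _ h1 h2 h3 h4
    · rw [← chordSign_symm lexSign lexSign_antisymm, add_comm]
      exact chordSign_east_south hm _ _ _ _ h1.symm h3.symm h2.symm h4.symm
    · exact chordSign_south_south hm _ _ _ _ h1 h2 h3 h4
  have right : ∀ (u v : Vertex m n) (d d' : Dir), (d = .east ∨ d = .south) →
      u ≠ v → u ≠ step v d' → step u d ≠ v →
      step u d ≠ step v d' → chordSign lexSign u (step u d) v (step v d') =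
      (-1) ^ (crossing (edgeAt u d) (edgeAt v d') + crossing (edgeAt v d') (edgeAt u d)) := by
    intro u v d d' hd h1 h2 h3 h4
    have key := main u (step v d') d d'.opp hd
    rw [step_step_opp, edgeAt_step_opp, chordSign_swap_right] at key
    cases d'
    · exact main u v d _ hd (.inl rfl) h1 h2 h3 h4
    · exact key (.inl rfl) h2 h1 h4 h3
    · exact main u v d _ hd (.inr rfl) h1 h2 h3 h4
    · exact key (.inr rfl) h2 h1 h4 h3
  have key := right (step u d) v d.opp d'
  rw [step_step_opp, edgeAt_step_opp, chordSign_swap_left] at key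
  cases d
  · exact right u v _ d' (.inl rfl) h1 h2 h3 h4
  · exact key (.inl rfl) h3 h4 h1 h2
  · exact right u v _ d' (.inr rfl) h1 h2 h3 h4
  · exact key (.inr rfl) h3 h4 h1 h2

/-! ### The sign change caused by a shift -/

/-- An enumeration of the white vertices. -/
noncomputable def whiteEnum (m n : ℕ) :
    Fin (Fintype.card {u : Vertex m n // IsWhite u}) ≃ {u : Vertex m n // IsWhite u} :=
  (Fintype.equivFin _).symm

/-- The sign of the number of crossings of the chords of a pairing. -/
noncomputable def crossSign (D : Vertex m n → Dir) : ℤ :=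
  ∏ i, ∏ j ∈ Finset.Ioi i, chordSign lexSign (whiteEnum m n i).1
    (step (whiteEnum m n i).1 (D (whiteEnum m n i).1)) (whiteEnum m n j).1
    (step (whiteEnum m n j).1 (D (whiteEnum m n j).1))

theorem prod_whiteEnum {R : Type*} [CommMonoid R] (φ : Vertex m n → R) :
    ∏ i, φ (whiteEnum m n i).1 = ∏ u : Vertex m n with IsWhite u, φ u := by
  rw [Equiv.prod_comp (whiteEnum m n) fun u => φ u.1]
  exact (Finset.prod_subtype _ (by simp) φ).symm

/-- The number of wrapping edges. -/
def wrapCount (M : Finset (Edge m n)) : ℕ := ∑ e ∈ M, if e.IsWrap then 1 else 0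

theorem prod_lexSign_step (hm : 2 ≤ m) (hn : 2 ≤ n) (hm' : Even m) (hn' : Even n)
    {D : Vertex m n → Dir} (hD : IsPairing D) :
    ∏ u : Vertex m n with IsWhite u, lexSign u (step u (D u)) =
      (∏ u : Vertex m n with IsWhite u, (D u).sgn) * (-1) ^ wrapCount (edgesOf D) := by
  rw [wrapCount, hD.sum_edgesOf_white hm' hn', ← Finset.prod_pow_eq_pow_sum,
    ← Finset.prod_mul_distrib]
  exact Finset.prod_congr rfl fun u _ => lexSign_step hm hn u _

section Shift

variable {D : Vertex m n → Dir} {C : List (Vertex m n)} {c : Equiv.Perm (Vertex m n)}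

theorem IsShift.isWhite_apply (h : IsShift D C c) (u : Vertex m n) :
    IsWhite (c u) ↔ IsWhite u := by
  by_cases hu : u ∈ C
  · exact iff_of_true (h.white _ ((h.apply_mem_iff u).2 hu)) (h.white _ hu)
  · rw [h.apply_of_notMem u hu]

theorem IsShift.isWhite_inv_apply (h : IsShift D C c) (u : Vertex m n) :
    IsWhite (c⁻¹ u) ↔ IsWhite u := by
  rw [← h.isWhite_apply, show c (c⁻¹ u) = u from c.apply_symm_apply u]

theorem IsShift.inv_apply_of_notMem (h : IsShift D C c) {u : Vertex m n} (hu : u ∉ C) :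
    c⁻¹ u = u := by
  rw [Equiv.Perm.inv_eq_iff_eq, h.apply_of_notMem u hu]

theorem IsShift.step_shift_white (hm : Even m) (hn : Even n) (h : IsShift D C c)
    {u : Vertex m n} (hw : IsWhite u) :
    step u (shift D C c u) = step (c⁻¹ u) (D (c⁻¹ u)) := by
  by_cases hu : u ∈ C
  · exact h.step_shift hu
  · rw [h.shift_apply_white_of_notMem hm hn hw hu, h.inv_apply_of_notMem hu]

/-- On the cycle the new directions are the reversed old ones, displaced by `c`; reindexing the
product by `c⁻¹` removes the displacement. -/
theorem IsShift.prod_sgn_shift (hm : Even m) (hn : Even n) (h : IsShift D C c)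
    (hC : C.Nodup) :
    ∏ u : Vertex m n with IsWhite u, (shift D C c u).sgn =
      (-1) ^ C.length * ∏ u : Vertex m n with IsWhite u, (D u).sgn := by
  have h1 : ∏ u : Vertex m n with IsWhite u, (D u).sgn =
      ∏ u : Vertex m n with IsWhite u, (D (c⁻¹ u)).sgn := by
    symm
    refine Finset.prod_equiv c⁻¹ (fun u => ?_) (fun u _ => rfl)
    simp only [Finset.mem_filter, Finset.mem_univ, true_and]
    exact (h.isWhite_inv_apply u).symm
  have h2 : ((-1 : ℤ)) ^ C.length =
      ∏ u : Vertex m n with IsWhite u, if u ∈ C.toFinset then -1 else 1 := by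
    rw [Finset.prod_ite, Finset.prod_const, Finset.prod_const_one, mul_one,
      ← List.toFinset_card_of_nodup hC]
    congr 2
    ext u
    simp only [List.mem_toFinset, Finset.mem_filter, Finset.mem_univ, true_and]
    exact ⟨fun hu => ⟨h.white u hu, hu⟩, fun hu => hu.2⟩
  rw [h1, h2, ← Finset.prod_mul_distrib]
  refine Finset.prod_congr rfl fun u hu => ?_
  simp only [Finset.mem_filter, Finset.mem_univ, true_and] at hu
  by_cases hC' : u ∈ C
  · rw [IsShift.shift_apply_white hC', Dir.sgn_opp, if_pos (List.mem_toFinset.2 hC')]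
    ring
  · rw [h.shift_apply_white_of_notMem hm hn hu hC', h.inv_apply_of_notMem hC',
      if_neg (fun h' => hC' (List.mem_toFinset.1 h')), one_mul]

/-- The shift keeps the white vertices and permutes their partners by `c⁻¹`, which has the same sign
as `c`. -/
theorem IsShift.crossSign_shift (hm : Even m) (hn : Even n) (h : IsShift D C c) :
    crossSign (shift D C c) *
        ∏ u : Vertex m n with IsWhite u, lexSign u (step u (shift D C c u)) =
      Equiv.Perm.sign c *
        (crossSign D * ∏ u : Vertex m n with IsWhite u, lexSign u (step u (D u))) := by
  set p : Equiv.Perm {u : Vertex m n // IsWhite u} :=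
    c⁻¹.subtypePerm h.isWhite_inv_apply with hp
  have hsign : Equiv.Perm.sign ((whiteEnum m n).symm.permCongr p) = Equiv.Perm.sign c := by
    rw [Equiv.Perm.sign_permCongr, hp, Equiv.Perm.sign_subtypePerm, Equiv.Perm.sign_inv]
    intro u hu
    by_contra hw
    exact hu (h.inv_apply_of_notMem fun hC => hw (h.white u hC))
  have key := prod_chordSign_comp lexSign lexSign_antisymm (fun i => (whiteEnum m n i).1)
    (fun i => step (whiteEnum m n i).1 (D (whiteEnum m n i).1))
    ((whiteEnum m n).symm.permCongr p)
  rw [hsign] at key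
  have hstep : ∀ i, step (whiteEnum m n ((whiteEnum m n).symm.permCongr p i)).1
      (D (whiteEnum m n ((whiteEnum m n).symm.permCongr p i)).1) =
      step (whiteEnum m n i).1 (shift D C c (whiteEnum m n i).1) := by
    intro i
    rw [h.step_shift_white hm hn (whiteEnum m n i).2]
    simp [hp, Equiv.permCongr_apply]
  simp only [hstep] at key
  rw [prod_whiteEnum fun u => lexSign u (step u (shift D C c u)),
    prod_whiteEnum fun u => lexSign u (step u (D u))] at key
  exact key

theorem IsShift.crossSign_mul_wrap (hm : 2 ≤ m) (hn : 2 ≤ n) (hm' : Even m) (hn' : Even n)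
    (hD : IsPairing D) (h : IsShift D C c) (hC : C.Nodup)
    (hsign : Equiv.Perm.sign c = -(-1) ^ C.length) :
    crossSign (shift D C c) * (-1) ^ wrapCount (edgesOf (shift D C c)) =
      -(crossSign D * (-1) ^ wrapCount (edgesOf D)) := by
  have key := h.crossSign_shift hm' hn'
  rw [prod_lexSign_step hm hn hm' hn' (h.isPairing_shift hm' hn' hD),
    prod_lexSign_step hm hn hm' hn' hD, h.prod_sgn_shift hm' hn' hC, hsign] at key
  have hsq : (∏ u : Vertex m n with IsWhite u, (D u).sgn) *
      (∏ u : Vertex m n with IsWhite u, (D u).sgn) = 1 := by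
    rw [← Finset.prod_mul_distrib]
    exact Finset.prod_eq_one fun u _ => by cases D u <;> rfl
  have hsq' : ((-1 : ℤ)) ^ C.length * (-1) ^ C.length = 1 := by
    rw [← mul_pow]
    simp
  push_cast at key
  generalize crossSign (shift D C c) = a at *
  generalize crossSign D = b at *
  generalize (∏ u : Vertex m n with IsWhite u, (D u).sgn) = s at *
  generalize ((-1 : ℤ)) ^ C.length = l at *
  generalize ((-1 : ℤ)) ^ wrapCount (edgesOf (shift D C c)) = x at *
  generalize ((-1 : ℤ)) ^ wrapCount (edgesOf D) = y at *
  -- The factors `l` and `s` are signs; multiplying by them once more cancels them.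
  linear_combination (l * s) * key - (a * x) * (l * l * hsq + hsq') - b * y * (l * l * hsq + hsq')

end Shift

theorem crossSign_mul_wrap_shiftCycle (hm : 2 ≤ m) (hn : 2 ≤ n) (hm' : Even m) (hn' : Even n)
    {w : Vertex m n} (hw : IsWhite w) {D : Vertex m n → Dir} (hD : IsPairing D) :
    crossSign (shiftCycle D w) * (-1) ^ wrapCount (edgesOf (shiftCycle D w)) =
      -(crossSign D * (-1) ^ wrapCount (edgesOf D)) := by
  obtain ⟨t, K, h⟩ := exists_isRho (advance D) w
  rw [shiftCycle_eq h]
  refine (isShift_cycle hm' hn' hw h).crossSign_mul_wrap hm hn hm' hn' hD h.nodup_cycleList ?_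
  rw [h.sign_cyclePerm, length_cycleList]

/-- `crossing` splits the crossing parity of a pair into two ordered contributions and vanishes on
the diagonal, so the product over unordered pairs becomes a sum over all ordered pairs, which can be
evaluated edge by edge. -/
theorem crossSign_eq (hm : 2 ≤ m) (hm' : Even m) (hn' : Even n) {D : Vertex m n → Dir}
    (hD : IsPairing D) :
    crossSign D = (-1) ^ ∑ e ∈ edgesOf D, ∑ e' ∈ edgesOf D, crossing e e' := by
  have h1 : ∀ i j, i ≠ j → chordSign lexSign (whiteEnum m n i).1
      (step (whiteEnum m n i).1 (D (whiteEnum m n i).1)) (whiteEnum m n j).1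
      (step (whiteEnum m n j).1 (D (whiteEnum m n j).1)) =
      (-1) ^ crossing (edgeAt (whiteEnum m n j).1 (D (whiteEnum m n j).1))
          (edgeAt (whiteEnum m n i).1 (D (whiteEnum m n i).1)) *
        (-1) ^ crossing (edgeAt (whiteEnum m n i).1 (D (whiteEnum m n i).1))
          (edgeAt (whiteEnum m n j).1 (D (whiteEnum m n j).1)) := by
    intro i j hij
    have hne : (whiteEnum m n i).1 ≠ (whiteEnum m n j).1 := fun h =>
      hij ((whiteEnum m n).injective (Subtype.ext h))
    have hi := (whiteEnum m n i).2
    have hj := (whiteEnum m n j).2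
    rw [chordSign_eq_crossing hm hne, pow_add, mul_comm]
    · intro h
      rw [h, isWhite_step hm' hn'] at hi
      exact hi hj
    · intro h
      rw [← h, isWhite_step hm' hn'] at hj
      exact hj hi
    · intro h
      apply hne
      have h2 := congrArg (fun u => step u (D u)) h
      simpa [hD _] using h2
  have h2 : crossSign D = ∏ i, ∏ j ∈ Finset.Ioi i,
      (-1) ^ crossing (edgeAt (whiteEnum m n j).1 (D (whiteEnum m n j).1))
          (edgeAt (whiteEnum m n i).1 (D (whiteEnum m n i).1)) *
        (-1) ^ crossing (edgeAt (whiteEnum m n i).1 (D (whiteEnum m n i).1))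
          (edgeAt (whiteEnum m n j).1 (D (whiteEnum m n j).1)) :=
    Finset.prod_congr rfl fun i _ => Finset.prod_congr rfl fun j hj =>
      h1 i j (Finset.mem_Ioi.1 hj).ne
  have h3 := prod_Ioi_mul_prod_diag fun i j => ((-1) : ℤ) ^
    crossing (edgeAt (whiteEnum m n i).1 (D (whiteEnum m n i).1))
      (edgeAt (whiteEnum m n j).1 (D (whiteEnum m n j).1))
  simp only [crossing_self, pow_zero, Finset.prod_const_one, mul_one] at h3
  rw [h2, h3, hD.sum_edgesOf_white hm' hn', ← Finset.prod_pow_eq_pow_sum, Finset.prod_comm,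
    prod_whiteEnum fun u => ∏ j, ((-1) : ℤ) ^ crossing (edgeAt u (D u))
      (edgeAt (whiteEnum m n j).1 (D (whiteEnum m n j).1))]
  refine Finset.prod_congr rfl fun u _ => ?_
  rw [hD.sum_edgesOf_white hm' hn', ← Finset.prod_pow_eq_pow_sum,
    prod_whiteEnum fun v => ((-1) : ℤ) ^ crossing (edgeAt u (D u)) (edgeAt v (D v))]

/-! ### Counting crossings and wraps modulo two -/

/-- The cyclic successor as a permutation. -/
def nextEquiv (n : ℕ) : Fin n ≃ Fin n := ⟨next, prev, prev_next, next_prev⟩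

theorem sum_next {A : Type*} [AddCommMonoid A] (φ : Fin n → A) : ∑ i, φ (next i) = ∑ i, φ i :=
  Equiv.sum_comp (nextEquiv n) φ

/-- An edge is horizontal or vertical. -/
def edgeEquiv (m n : ℕ) : (Fin m × Fin n) ⊕ (Fin m × Fin n) ≃ Edge m n where
  toFun := Sum.elim (fun p => .horizontal p.1 p.2) fun p => .vertical p.1 p.2
  invFun
    | .horizontal i j => .inl (i, j)
    | .vertical i j => .inr (i, j)
  left_inv := by rintro (p | p) <;> rfl
  right_inv := by rintro (_ | _) <;> rfl

theorem IsPairing.sum_edgesOf {D : Vertex m n → Dir} (hD : IsPairing D) {A : Type*}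
    [AddCommMonoid A] (φ : Edge m n → A) :
    ∑ e ∈ edgesOf D, φ e = (∑ i, ∑ j, if D (i, j) = .east then φ (.horizontal i j) else 0) +
      ∑ i, ∑ j, if D (i, j) = .south then φ (.vertical i j) else 0 := by
  rw [← Finset.univ_inter (edgesOf D), ← Finset.sum_ite_mem, ← Equiv.sum_comp (edgeEquiv m n),
    Fintype.sum_sum_type, Fintype.sum_prod_type, Fintype.sum_prod_type]
  have hH : ∀ i j, Edge.horizontal i j ∈ edgesOf D ↔ D (i, j) = .east := fun i j =>
    hD.edgeAt_mem_iff (u := (i, j)) (d := .east)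
  have hV : ∀ i j, Edge.vertical i j ∈ edgesOf D ↔ D (i, j) = .south := fun i j =>
    hD.edgeAt_mem_iff (u := (i, j)) (d := .south)
  simp [edgeEquiv, hH, hV]

/-- The indicator of a direction at a vertex, modulo two. -/
def ind (D : Vertex m n → Dir) (d : Dir) (i : Fin m) (j : Fin n) : ZMod 2 :=
  if D (i, j) = d then 1 else 0

theorem two_mul_zmod (a : ZMod 2) : 2 * a = 0 := by
  rw [show (2 : ZMod 2) = 0 from rfl, zero_mul]

theorem cast_even {k : ℕ} (hk : Even k) : (k : ZMod 2) = 0 :=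
  (ZMod.natCast_eq_zero_iff_even).2 hk

section Parity

variable {D : Vertex m n → Dir}

theorem ind_sum (D : Vertex m n → Dir) (i : Fin m) (j : Fin n) :
    ind D .east i j + ind D .west i j + (ind D .south i j + ind D .north i j) = 1 := by
  simp only [ind]
  cases D (i, j) <;> simp

theorem IsPairing.ind_west (hD : IsPairing D) (i : Fin m) (j : Fin n) :
    ind D .west i (next j) = ind D .east i j := by
  have h : D (i, next j) = .west ↔ D (i, j) = .east := by
    rw [← hD.edgeAt_mem_iff, ← hD.edgeAt_mem_iff, edgeAt, edgeAt, prev_next]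
  simp only [ind, h]

theorem IsPairing.ind_north (hD : IsPairing D) (i : Fin m) (j : Fin n) :
    ind D .north (next i) j = ind D .south i j := by
  have h : D (next i, j) = .north ↔ D (i, j) = .south := by
    rw [← hD.edgeAt_mem_iff, ← hD.edgeAt_mem_iff, edgeAt, edgeAt, prev_next]
  simp only [ind, h]

theorem IsPairing.sum_horizontal_row (hD : IsPairing D) (i : Fin m) :
    ∑ j, (ind D .east i j + ind D .west i j) = 0 := by
  rw [Finset.sum_add_distrib, ← sum_next fun j => ind D .west i j]
  simp only [hD.ind_west]
  rw [← two_mul, two_mul_zmod]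

theorem IsPairing.sum_vertical_col (hD : IsPairing D) (j : Fin n) :
    ∑ i, (ind D .south i j + ind D .north i j) = 0 := by
  rw [Finset.sum_add_distrib, ← sum_next fun i => ind D .north i j]
  simp only [hD.ind_north]
  rw [← two_mul, two_mul_zmod]

/-- The horizontally matched vertices of a row come in pairs, and the row has even length. -/
theorem IsPairing.sum_vertical_row (hn : Even n) (hD : IsPairing D) (i : Fin m) :
    ∑ j, (ind D .south i j + ind D .north i j) = 0 := by
  have h : ∑ j : Fin n, (ind D .east i j + ind D .west i j +
      (ind D .south i j + ind D .north i j)) = n := by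
    simp [ind_sum]
  rw [Finset.sum_add_distrib, hD.sum_horizontal_row, zero_add, cast_even hn] at h
  exact h

theorem IsPairing.sum_horizontal_col (hm : Even m) (hD : IsPairing D) (j : Fin n) :
    ∑ i, (ind D .east i j + ind D .west i j) = 0 := by
  have h : ∑ i : Fin m, (ind D .east i j + ind D .west i j +
      (ind D .south i j + ind D .north i j)) = m := by
    simp [ind_sum]
  rw [Finset.sum_add_distrib, hD.sum_vertical_col, add_zero, cast_even hm] at h
  exact h

theorem eq_of_next_eq {A : Type*} (φ : Fin n → A) (h : ∀ i, φ (next i) = φ i) (i j : Fin n) :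
    φ i = φ j := by
  have h0 : ∀ k (hk : k < n), φ ⟨k, hk⟩ = φ ⟨0, by omega⟩ := by
    intro k
    induction k with
    | zero => exact fun _ => rfl
    | succ k ih =>
      intro hk
      rw [← ih (by omega), ← h ⟨k, by omega⟩]
      congr 1
      apply Fin.ext
      rw [val_next, if_neg]
      exact hk.ne
  rw [h0 i.val i.isLt, h0 j.val j.isLt]

/-- The vertically matched vertices of a row are even in number and are joined to the row above or
below, so neighbouring layers have equal parity. -/
theorem IsPairing.sum_south_eq (hn : Even n) (hD : IsPairing D) (i i' : Fin m) :
    ∑ j, ind D .south i j = ∑ j, ind D .south i' j := by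
  refine eq_of_next_eq (fun i => ∑ j, ind D .south i j) (fun i => ?_) i i'
  have h := hD.sum_vertical_row hn (next i)
  simp only [hD.ind_north, Finset.sum_add_distrib] at h
  have h2 := two_mul_zmod (∑ j, ind D .south i j)
  linear_combination h - h2

theorem IsPairing.sum_east_eq (hm : Even m) (hD : IsPairing D) (j j' : Fin n) :
    ∑ i, ind D .east i j = ∑ i, ind D .east i j' := by
  refine eq_of_next_eq (fun j => ∑ i, ind D .east i j) (fun j => ?_) j j'
  have h := hD.sum_horizontal_col hm (next j)
  simp only [hD.ind_west, Finset.sum_add_distrib] at h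
  have h2 := two_mul_zmod (∑ i, ind D .east i j)
  linear_combination h - h2

/-- Before a vertex of a row, the horizontally matched vertices come in pairs, up to the ends. -/
theorem IsPairing.sum_horizontal_prefix (hD : IsPairing D) (hn : 0 < n) (i : Fin m) (k : Fin n) :
    ∑ j, (if j.val < k.val then ind D .east i j + ind D .west i j else 0) =
      ind D .west i ⟨0, hn⟩ + ind D .west i k := by
  have key : ∀ k (hk : k < n), ∑ j : Fin n, (if j.val < k then ind D .east i j + ind D .west i j
      else 0) = ind D .west i ⟨0, hn⟩ + ind D .west i ⟨k, hk⟩ := by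
    intro k
    induction k with
    | zero =>
      intro hk
      simp [CharTwo.add_self_eq_zero]
    | succ k ih =>
      intro hk
      have h1 : ∀ j : Fin n, (if j.val < k + 1 then ind D .east i j + ind D .west i j else 0) =
          (if j.val < k then ind D .east i j + ind D .west i j else 0) +
            if j = ⟨k, by omega⟩ then ind D .east i j + ind D .west i j else 0 := by
        intro j
        rcases lt_trichotomy j.val k with h | h | h
        · rw [if_pos (by omega), if_pos h, if_neg (by rw [Fin.ext_iff]; exact h.ne), add_zero]
        · rw [if_pos (by omega), if_neg (by omega), if_pos (by rw [Fin.ext_iff]; exact h), zero_add]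
        · rw [if_neg (by omega), if_neg (by omega), if_neg (by rw [Fin.ext_iff]; exact h.ne'),
            add_zero]
      rw [Finset.sum_congr rfl fun j _ => h1 j, Finset.sum_add_distrib, ih (by omega),
        Finset.sum_ite_eq' Finset.univ]
      have h2 : (⟨k + 1, hk⟩ : Fin n) = next ⟨k, by omega⟩ := by
        apply Fin.ext
        rw [val_next, if_neg]
        exact hk.ne
      rw [h2, hD.ind_west, if_pos (Finset.mem_univ _)]
      have h3 := two_mul_zmod (ind D .west i ⟨k, by omega⟩)
      linear_combination h3
  exact key k.val k.isLt

theorem sum_lt_const (k : Fin n) :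
    ∑ j : Fin n, (if j.val < k.val then (1 : ZMod 2) else 0) = k.val := by
  rw [Finset.sum_boole]
  congr 1
  rw [← Fin.card_Iio k]
  congr 1
  ext j
  simp

/-- The edges charged to this one are those meeting row `next i` from above or starting there, in
columns before `j`. They correspond to the vertically matched vertices among the first `j` of that
row. The others come in horizontal pairs, except for a possible wrapping edge at column 0; no pair
is cut at column `j`, because that vertex is matched northwards. -/
theorem sum_crossing_vertical (hm : 2 ≤ m) (hn : 0 < n) (hD : IsPairing D) {i : Fin m} {j : Fin n}
    (hij : D (i, j) = .south) :
    ((∑ e ∈ edgesOf D, crossing (.vertical i j) e : ℕ) : ZMod 2) =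
      j.val + ind D .west (next i) ⟨0, hn⟩ := by
  have hN : D (next i, j) = .north := by
    rw [← hD.edgeAt_mem_iff, edgeAt, prev_next]
    exact hD.edgeAt_mem_iff (u := (i, j)).2 hij
  have hW : ind D .west (next i) j = 0 := by simp [ind, hN]
  rw [hD.sum_edgesOf]
  simp only [crossing, ite_self, Finset.sum_const_zero, zero_add]
  push_cast
  have h1 : ∀ i' j', (if D (i', j') = .south then
      (if j'.val < j.val ∧ (i' = i ∨ i' = next i) then (1 : ZMod 2) else 0) else 0) =
      (if i' = i then (if j'.val < j.val then ind D .south i j' else 0) else 0) +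
      (if i' = next i then (if j'.val < j.val then ind D .south (next i) j' else 0) else 0) := by
    intro i' j'
    by_cases ha : i' = i
    · subst ha
      by_cases hj : j'.val < j.val <;> simp [hj, ind, (next_ne hm i').symm]
    · by_cases hb : i' = next i
      · subst hb
        by_cases hj : j'.val < j.val <;> simp [hj, ind, next_ne hm i]
      · simp [ha, hb]
  simp only [h1, Finset.sum_add_distrib]
  rw [Finset.sum_comm, Finset.sum_comm (f := fun i' j' => if i' = next i then
    (if j'.val < j.val then ind D .south (next i) j' else 0) else 0)]
  simp only [Finset.sum_ite_eq', Finset.mem_univ, if_true]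
  rw [← Finset.sum_add_distrib]
  have h2 : ∀ j' : Fin n, (if j'.val < j.val then ind D .south i j' else 0) +
      (if j'.val < j.val then ind D .south (next i) j' else 0) =
      (if j'.val < j.val then (1 : ZMod 2) else 0) -
      if j'.val < j.val then ind D .east (next i) j' + ind D .west (next i) j' else 0 := by
    intro j'
    have h3 := ind_sum D (next i) j'
    rw [hD.ind_north] at h3
    split_ifs
    · linear_combination h3
    · ring
  rw [Finset.sum_congr rfl fun j' _ => h2 j', Finset.sum_sub_distrib, sum_lt_const,
    hD.sum_horizontal_prefix hn, hW, add_zero, CharTwo.sub_eq_add]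

/-- Only a wrapping edge can contribute; it counts the vertically matched vertices of its row, an
even number. -/
theorem sum_crossing_horizontal (hm : 2 ≤ m) (hn : Even n) (hD : IsPairing D) (i : Fin m)
    (j : Fin n) :
    ((∑ e ∈ edgesOf D, crossing (.horizontal i j) e : ℕ) : ZMod 2) = 0 := by
  rw [hD.sum_edgesOf]
  simp only [crossing, ite_self, Finset.sum_const_zero, zero_add]
  push_cast
  by_cases hj : j.val + 1 = n
  · obtain ⟨p, rfl⟩ : ∃ p, i = next p := ⟨prev i, (next_prev i).symm⟩
    have h1 : ∀ i' j', (if D (i', j') = .south then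
        (if j.val + 1 = n ∧ (i' = next p ∨ next i' = next p) then (1 : ZMod 2) else 0) else 0) =
        (if i' = p then ind D .south p j' else 0) +
        (if i' = next p then ind D .south (next p) j' else 0) := by
      intro i' j'
      simp only [next_injective.eq_iff]
      by_cases ha : i' = p
      · subst ha
        simp [hj, ind, (next_ne hm i').symm]
      · by_cases hb : i' = next p
        · subst hb
          simp [hj, ind, next_ne hm p]
        · simp [ha, hb]
    simp only [h1, Finset.sum_add_distrib]
    rw [Finset.sum_comm, Finset.sum_comm (f := fun i' j' => if i' = next p then
      ind D .south (next p) j' else 0)]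
    simp only [Finset.sum_ite_eq', Finset.mem_univ, if_true]
    have h2 := hD.sum_vertical_row hn (next p)
    simp only [hD.ind_north, Finset.sum_add_distrib] at h2
    rw [add_comm, h2]
  · simp [hj]

theorem isWrap_horizontal (i : Fin m) (j : Fin n) :
    (Edge.horizontal i j).IsWrap ↔ j.val + 1 = n := Iff.rfl

theorem isWrap_vertical (i : Fin m) (j : Fin n) :
    (Edge.vertical i j).IsWrap ↔ i.val + 1 = m := Iff.rfl

/-- The parity of the number of crossings in terms of the numbers of edges in two layers. -/
theorem sum_crossing (hm : 2 ≤ m) (hn : 0 < n) (hm' : Even m) (hn' : Even n) (hD : IsPairing D)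
    (a : Fin n) (b : Fin m) :
    ((∑ e ∈ edgesOf D, ∑ e' ∈ edgesOf D, crossing e e' : ℕ) : ZMod 2) =
      ∑ j, (j.val : ZMod 2) * ∑ i, ind D .south i j +
        (∑ i, ind D .east i a) * ∑ j, ind D .south b j := by
  rw [hD.sum_edgesOf]
  push_cast [Nat.cast_ite]
  have h1 : ∀ i j, (if D (i, j) = .east then
      ∑ e ∈ edgesOf D, (crossing (.horizontal i j) e : ZMod 2) else 0) = 0 := by
    intro i j
    have := sum_crossing_horizontal hm hn' hD i j
    push_cast at this
    rw [this, ite_self]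
  have h2 : ∀ i j, (if D (i, j) = .south then
      ∑ e ∈ edgesOf D, (crossing (.vertical i j) e : ZMod 2) else 0) =
      j.val * ind D .south i j + ind D .west (next i) ⟨0, hn⟩ * ind D .south i j := by
    intro i j
    by_cases hij : D (i, j) = .south
    · have := sum_crossing_vertical hm hn hD hij
      push_cast at this
      rw [if_pos hij, this, ind, ind, if_pos hij, mul_one, mul_one]
    · simp [ind, hij]
  simp only [h1, h2, Finset.sum_const_zero, zero_add, Finset.sum_add_distrib]
  rw [Finset.sum_comm]
  simp only [← Finset.mul_sum]
  congr 1
  -- All vertical layers have the same parity, so the correction terms factor into this parity times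
  -- the parity of the wrapping horizontal edges.
  have h3 : ∀ i, ∑ j, ind D .south i j = ∑ j, ind D .south b j := fun i =>
    hD.sum_south_eq hn' i b
  simp only [h3]
  rw [← Finset.sum_mul, sum_next fun i => ind D .west i ⟨0, hn⟩]
  congr 1
  rw [hD.sum_east_eq hm' a (prev ⟨0, hn⟩)]
  exact Finset.sum_congr rfl fun i _ => by rw [← hD.ind_west, next_prev]

/-- Wrapping edges form one horizontal and one vertical layer, and the parity of a layer does not
depend on its position. -/
theorem wrapCount_eq (hm : Even m) (hn : Even n) (hD : IsPairing D) (a : Fin n) (b : Fin m) :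
    (wrapCount (edgesOf D) : ZMod 2) = ∑ i, ind D .east i a + ∑ j, ind D .south b j := by
  have ha := a.isLt
  have hb := b.isLt
  rw [wrapCount, hD.sum_edgesOf]
  push_cast [Nat.cast_ite]
  simp only [isWrap_horizontal, isWrap_vertical]
  have h1 : ∀ i j, (if D (i, j) = .east then (if j.val + 1 = n then (1 : ZMod 2) else 0) else 0) =
      if j = ⟨n - 1, by omega⟩ then ind D .east i j else 0 := by
    intro i j
    have : j.val + 1 = n ↔ j = ⟨n - 1, by omega⟩ := by rw [Fin.ext_iff]; simp only; omega
    simp only [this, ind]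
    split_ifs <;> rfl
  have h2 : ∀ i j, (if D (i, j) = .south then (if i.val + 1 = m then (1 : ZMod 2) else 0) else 0) =
      if i = ⟨m - 1, by omega⟩ then ind D .south i j else 0 := by
    intro i j
    have : i.val + 1 = m ↔ i = ⟨m - 1, by omega⟩ := by rw [Fin.ext_iff]; simp only; omega
    simp only [this, ind]
    split_ifs <;> rfl
  simp only [h1, h2, Finset.sum_ite_eq', Finset.mem_univ, if_true]
  rw [Finset.sum_comm (f := fun i j => if i = (⟨m - 1, by omega⟩ : Fin m) then
    ind D .south i j else 0)]
  simp only [Finset.sum_ite_eq', Finset.mem_univ, if_true]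
  rw [hD.sum_east_eq hm a ⟨n - 1, by omega⟩, hD.sum_south_eq hn b ⟨m - 1, by omega⟩]

end Parity

theorem neg_one_pow_eq_iff (a b : ℕ) :
    ((-1 : ℤ)) ^ a = (-1) ^ b ↔ (a : ZMod 2) = b := by
  rw [ZMod.natCast_eq_natCast_iff, Nat.ModEq, neg_one_pow_eq_pow_mod_two,
    neg_one_pow_eq_pow_mod_two (n := b)]
  rcases Nat.mod_two_eq_zero_or_one a with h | h <;>
    rcases Nat.mod_two_eq_zero_or_one b with h' | h' <;> simp [h, h']

/-- Shifting along the cycle swaps the even and the odd pairings. -/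
theorem parity_shiftCycle (hm : 2 ≤ m) (hn : 2 ≤ n) (hm' : Even m) (hn' : Even n) {w : Vertex m n}
    (hw : IsWhite w) {D : Vertex m n → Dir} (hD : IsPairing D)
    (hcol : ∀ j, ∑ i, ind (shiftCycle D w) .south i j = ∑ i, ind D .south i j)
    (a : Fin n) (b : Fin m) :
    (∑ i, ind (shiftCycle D w) .east i a = 0 ∧ ∑ j, ind (shiftCycle D w) .south b j = 0) ↔
      ¬ (∑ i, ind D .east i a = 0 ∧ ∑ j, ind D .south b j = 0) := by
  have hD' := isPairing_shiftCycle hm' hn' hw hD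
  have key := crossSign_mul_wrap_shiftCycle hm hn hm' hn' hw hD
  rw [crossSign_eq hm hm' hn' hD', crossSign_eq hm hm' hn' hD, ← pow_add, ← pow_add,
    ← neg_one_mul ((-1 : ℤ) ^ _), ← pow_succ', neg_one_pow_eq_iff, Nat.cast_add, Nat.cast_succ,
    Nat.cast_add, wrapCount_eq hm' hn' hD' a b, wrapCount_eq hm' hn' hD a b,
    sum_crossing hm (by omega) hm' hn' hD' a b, sum_crossing hm (by omega) hm' hn' hD a b] at key
  simp only [hcol] at key
  generalize ∑ i, ind (shiftCycle D w) .east i a = x' at *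
  generalize ∑ j, ind (shiftCycle D w) .south b j = y' at *
  generalize ∑ i, ind D .east i a = x at *
  generalize ∑ j, ind D .south b j = y at *
  generalize ∑ j : Fin n, (j.val : ZMod 2) * ∑ i, ind D .south i j = z at *
  clear hcol
  -- What remains is that $xy+x+y = 1+(1+x)(1+y)$ is zero modulo 2 only for $x=y=0$.
  revert x' y' x y z
  decide

/-! ### Preservation of the prescribed counts -/

section Counts

theorem edgeAt_opp_mem_horizontalCycle (u : Vertex m n) (d : Dir) (i : Fin m) :
    edgeAt u d.opp ∈ horizontalCycle i ↔ edgeAt u d ∈ horizontalCycle i := by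
  cases d <;> simp [horizontalCycle, edgeAt, Dir.opp]

theorem edgeAt_opp_mem_verticalCycle (u : Vertex m n) (d : Dir) (j : Fin n) :
    edgeAt u d.opp ∈ verticalCycle j ↔ edgeAt u d ∈ verticalCycle j := by
  cases d <;> simp [verticalCycle, edgeAt, Dir.opp]

theorem card_inter_eq_sum (M S : Finset (Edge m n)) :
    (M ∩ S).card = ∑ e ∈ M, if e ∈ S then 1 else 0 := by
  rw [Finset.card_eq_sum_ones, ← Finset.sum_ite_mem]

/-- Edges are counted at their black ends: there a shift at most reverses the direction, whereas the
directions at white vertices are moved to other places. -/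
theorem IsShift.card_inter_shift (hm : Even m) (hn : Even n) {D : Vertex m n → Dir}
    {C : List (Vertex m n)} {c : Equiv.Perm (Vertex m n)} (h : IsShift D C c) (hD : IsPairing D)
    (S : Finset (Edge m n)) (hS : ∀ u d, edgeAt u d.opp ∈ S ↔ edgeAt u d ∈ S) :
    (edgesOf (shift D C c) ∩ S).card = (edgesOf D ∩ S).card := by
  rw [card_inter_eq_sum, card_inter_eq_sum, hD.sum_edgesOf_black hm hn,
    (h.isPairing_shift hm hn hD).sum_edgesOf_black hm hn]
  refine Finset.sum_congr rfl fun u hu => ?_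
  simp only [Finset.mem_filter, Finset.mem_univ, true_and] at hu
  have huC : u ∉ C := fun hC => hu (h.white u hC)
  rw [shift, if_neg huC]
  split_ifs <;> simp_all

theorem card_inter_shiftCycle (hm : Even m) (hn : Even n) {w : Vertex m n} (hw : IsWhite w)
    {D : Vertex m n → Dir} (hD : IsPairing D) (S : Finset (Edge m n))
    (hS : ∀ u d, edgeAt u d.opp ∈ S ↔ edgeAt u d ∈ S) :
    (edgesOf (shiftCycle D w) ∩ S).card = (edgesOf D ∩ S).card := by
  obtain ⟨t, K, h⟩ := exists_isRho (advance D) w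
  rw [shiftCycle_eq h]
  exact (isShift_cycle hm hn hw h).card_inter_shift hm hn hD S hS

variable {D : Vertex m n → Dir}

theorem IsPairing.card_inter_verticalCycle (hD : IsPairing D) (j : Fin n) :
    ((edgesOf D ∩ verticalCycle j).card : ZMod 2) = ∑ i, ind D .south i j := by
  rw [card_inter_eq_sum, hD.sum_edgesOf, Finset.sum_comm (f := fun i j' =>
    if D (i, j') = .south then (if Edge.vertical i j' ∈ verticalCycle j then 1 else 0) else 0),
    Finset.sum_eq_single_of_mem j (Finset.mem_univ _)]
  · simp [verticalCycle, ind]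
  · intro j' _ hj'
    simp [verticalCycle, hj'.symm]

theorem IsPairing.card_inter_verticalLayer (hD : IsPairing D) (b : Fin m) :
    ((edgesOf D ∩ verticalLayer b).card : ZMod 2) = ∑ j, ind D .south b j := by
  rw [card_inter_eq_sum, hD.sum_edgesOf, Finset.sum_eq_single_of_mem (s := Finset.univ)
    (f := fun i => ∑ j, if D (i, j) = .south then
      (if Edge.vertical i j ∈ verticalLayer b then 1 else 0) else 0) b (Finset.mem_univ _)]
  · simp [verticalLayer, ind]
  · intro i _ hi
    simp [verticalLayer, hi.symm]

theorem IsPairing.card_inter_horizontalLayer (hD : IsPairing D) (a : Fin n) :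
    ((edgesOf D ∩ horizontalLayer a).card : ZMod 2) = ∑ i, ind D .east i a := by
  rw [card_inter_eq_sum, hD.sum_edgesOf, Finset.sum_comm (f := fun i j =>
    if D (i, j) = .east then (if Edge.horizontal i j ∈ horizontalLayer a then 1 else 0) else 0),
    Finset.sum_eq_single_of_mem a (Finset.mem_univ _)]
  · simp [horizontalLayer, ind]
  · intro j _ hj
    simp [horizontalLayer, hj.symm]

end Counts

/-! ### The bijection on perfect matchings -/

theorem two_le_of_pos_of_even {k : ℕ} (h : 0 < k) (h' : Even k) : 2 ≤ k := by
  obtain ⟨r, rfl⟩ := h'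
  omega

theorem isPairing_shiftCycle_dirOf (hm : 0 < m) (hm' : Even m) (hn : 0 < n) (hn' : Even n)
    (M : PerfectMatching m n) : IsPairing (shiftCycle (dirOf M) (corner hm hn)) :=
  isPairing_shiftCycle hm' hn' (isWhite_corner hm hn)
    (isPairing_dirOf (two_le_of_pos_of_even hm hm') (two_le_of_pos_of_even hn hn') M)

open Classical in
/-- The bijection between the even and the odd perfect matchings: shift the matching along the
cycle into which the walk from the corner runs. -/
noncomputable def flipMatching (m n : ℕ) (M : PerfectMatching m n) : PerfectMatching m n :=
  if h : (0 < m ∧ Even m) ∧ (0 < n ∧ Even n) then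
    ⟨edgesOf (shiftCycle (dirOf M) (corner h.1.1 h.2.1)),
      (isPairing_shiftCycle_dirOf h.1.1 h.1.2 h.2.1 h.2.2 M).isPerfectMatching⟩
  else M

section

variable (hm : 0 < m) (hm' : Even m) (hn : 0 < n) (hn' : Even n) (M : PerfectMatching m n)

include hm hm' hn hn'

theorem val_flipMatching :
    (flipMatching m n M).val = edgesOf (shiftCycle (dirOf M) (corner hm hn)) := by
  rw [flipMatching, dif_pos ⟨⟨hm, hm'⟩, ⟨hn, hn'⟩⟩]

theorem dirOf_flipMatching : dirOf (flipMatching m n M) = shiftCycle (dirOf M) (corner hm hn) := by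
  rw [← dirOf_edgesOf (two_le_of_pos_of_even hm hm') (two_le_of_pos_of_even hn hn')
    (isPairing_shiftCycle_dirOf hm hm' hn hn' M)]
  congr 1
  exact Subtype.ext (val_flipMatching hm hm' hn hn' M)

theorem flipMatching_flipMatching : flipMatching m n (flipMatching m n M) = M := by
  apply Subtype.ext
  have h2m := two_le_of_pos_of_even hm hm'
  have h2n := two_le_of_pos_of_even hn hn'
  rw [val_flipMatching hm hm' hn hn', dirOf_flipMatching hm hm' hn hn',
    shiftCycle_shiftCycle hm' hn' (isWhite_corner hm hn) (isPairing_dirOf h2m h2n M),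
    edgesOf_dirOf h2m h2n]

theorem card_inter_flipMatching (S : Finset (Edge m n))
    (hS : ∀ u d, edgeAt u d.opp ∈ S ↔ edgeAt u d ∈ S) :
    ((flipMatching m n M).val ∩ S).card = (M.val ∩ S).card := by
  have h2m := two_le_of_pos_of_even hm hm'
  have h2n := two_le_of_pos_of_even hn hn'
  rw [val_flipMatching hm hm' hn hn', card_inter_shiftCycle hm' hn' (isWhite_corner hm hn)
    (isPairing_dirOf h2m h2n M) S hS, edgesOf_dirOf h2m h2n]

theorem hasCounts_flipMatching (h : Fin m → ℕ) (v : Fin n → ℕ) :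
    HasCounts h v (flipMatching m n M) ↔ HasCounts h v M := by
  simp only [HasCounts, card_inter_flipMatching hm hm' hn hn' M _ fun u d =>
    edgeAt_opp_mem_horizontalCycle u d _, card_inter_flipMatching hm hm' hn hn' M _ fun u d =>
    edgeAt_opp_mem_verticalCycle u d _]

theorem isEven_iff (a : Fin n) (b : Fin m) :
    IsEven (horizontalLayer a) (verticalLayer b) M ↔
      ∑ i, ind (dirOf M) .east i a = 0 ∧ ∑ j, ind (dirOf M) .south b j = 0 := by
  have h2m := two_le_of_pos_of_even hm hm'
  have h2n := two_le_of_pos_of_even hn hn'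
  have hD := isPairing_dirOf h2m h2n M
  rw [IsEven, ← ZMod.natCast_eq_zero_iff_even, ← ZMod.natCast_eq_zero_iff_even,
    ← edgesOf_dirOf h2m h2n M, hD.card_inter_horizontalLayer, hD.card_inter_verticalLayer]

theorem isEven_flipMatching (a : Fin n) (b : Fin m) :
    IsEven (horizontalLayer a) (verticalLayer b) (flipMatching m n M) ↔
      ¬ IsEven (horizontalLayer a) (verticalLayer b) M := by
  have h2m := two_le_of_pos_of_even hm hm'
  have h2n := two_le_of_pos_of_even hn hn'
  have hD := isPairing_dirOf h2m h2n M
  rw [isEven_iff hm hm' hn hn', isEven_iff hm hm' hn hn', dirOf_flipMatching hm hm' hn hn']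
  refine parity_shiftCycle h2m h2n hm' hn' (isWhite_corner hm hn) hD (fun j => ?_) a b
  rw [← hD.card_inter_verticalCycle,
    ← (isPairing_shiftCycle_dirOf hm hm' hn hn' M).card_inter_verticalCycle,
    card_inter_shiftCycle hm' hn' (isWhite_corner hm hn) hD _ fun u d =>
      edgeAt_opp_mem_verticalCycle u d j]

end

theorem bijOn_flipMatching (hm : 0 < m) (hm' : Even m) (hn : 0 < n) (hn' : Even n)
    (a : Fin n) (b : Fin m) (h : Fin m → ℕ) (v : Fin n → ℕ) :
    Set.BijOn (flipMatching m n) (evenMatchings (horizontalLayer a) (verticalLayer b) h v)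
      (oddMatchings (horizontalLayer a) (verticalLayer b) h v) := by
  have hinv := flipMatching_flipMatching hm hm' hn hn'
  refine ⟨fun M hM => ?_, fun M _ M' _ heq => ?_, fun M hM => ⟨flipMatching m n M, ?_, hinv M⟩⟩
  · exact ⟨(hasCounts_flipMatching hm hm' hn hn' M h v).2 hM.1, fun he =>
      (isEven_flipMatching hm hm' hn hn' M a b).1 he hM.2⟩
  · rw [← hinv M, heq, hinv M']
  · exact ⟨(hasCounts_flipMatching hm hm' hn hn' M h v).2 hM.1,
      (isEven_flipMatching hm hm' hn hn' M a b).2 hM.2⟩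

/-! ### Performing the shift by a local walk -/

/-- The state of the walk that performs the shift: the current directions, the current vertex and
the direction in which it was entered. -/
structure WalkState (m n : ℕ) where
  dirs : Vertex m n → Dir
  pos : Vertex m n
  last : Dir

/-- One step of the walk: go along the current direction of the vertex, turn the direction of the
vertex back to where the walk came from, and reverse the direction of the vertex on the way. -/
def walkStep (S : WalkState m n) : WalkState m n where
  dirs := Function.update (Function.update S.dirs S.pos S.last.opp) (step S.pos (S.dirs S.pos))
    (S.dirs S.pos)
  pos := step (step S.pos (S.dirs S.pos)) (S.dirs S.pos)
  last := S.dirs S.pos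

/-- The state in which the walk from `w` starts. -/
def walkStart (D : Vertex m n → Dir) (w : Vertex m n) : WalkState m n := ⟨D, w, (D w).opp⟩

section Walk

variable {D : Vertex m n → Dir} {w : Vertex m n} {t K : ℕ}

/-- The walk is on its way for the first time along the orbit of `w`. -/
structure WalkOut (D : Vertex m n → Dir) (w : Vertex m n) (k : ℕ) (S : WalkState m n) : Prop where
  pos : S.pos = (advance D)^[k] w
  last : ∀ s, s + 1 = k → S.last = D ((advance D)^[s] w)
  white : ∀ s, s + 1 < k → S.dirs ((advance D)^[s + 1] w) = (D ((advance D)^[s] w)).opp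
  black : ∀ s < k, S.dirs (step ((advance D)^[s] w) (D ((advance D)^[s] w))) =
    D ((advance D)^[s] w)
  other : ∀ u, (∀ s < k, u ≠ (advance D)^[s] w) →
    (∀ s < k, u ≠ step ((advance D)^[s] w) (D ((advance D)^[s] w))) → S.dirs u = D u

theorem walkOut_start : WalkOut D w 0 (walkStart D w) where
  pos := rfl
  last := by simp
  white := by simp
  black := by simp
  other := fun _ _ _ => rfl

theorem iterate_ne_partner (hm : Even m) (hn : Even n) (D : Vertex m n → Dir) (w : Vertex m n)
    (a b : ℕ) : (advance D)^[a] w ≠ step ((advance D)^[b] w) (D ((advance D)^[b] w)) := by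
  intro h
  have h1 := isWhite_iterate_advance hm hn D w a
  rw [h, isWhite_step hm hn, isWhite_iterate_advance hm hn D w b] at h1
  tauto

theorem partner_injective (hD : IsPairing D) {u v : Vertex m n}
    (h : step u (D u) = step v (D v)) : u = v := by
  have h2 := congrArg (fun u => step u (D u)) h
  simpa [hD _] using h2

theorem WalkOut.step (hm : Even m) (hn : Even n) (hD : IsPairing D)
    (h : IsRho (advance D) w t K) {k : ℕ} (hk : k < K) {S : WalkState m n} (hS : WalkOut D w k S) :
    WalkOut D w (k + 1) (walkStep S) := by
  have hne := iterate_ne_partner hm hn D w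
  have hinj : ∀ s < k, (advance D)^[s] w ≠ (advance D)^[k] w := fun s hs he => by
    have := h.inj s (by omega) k hk he
    omega
  -- Before time `K` every vertex is visited for the first time, so its original direction is still
  -- there.
  have hread : S.dirs S.pos = D ((advance D)^[k] w) := by
    rw [hS.pos]
    exact hS.other _ (fun s hs => (hinj s hs).symm) fun s _ => hne k s
  have hpos : (walkStep S).pos = (advance D)^[k + 1] w := by
    rw [Function.iterate_succ_apply', advance, walkStep, hread, hS.pos]
  have hdirs : (walkStep S).dirs = Function.update (Function.update S.dirs ((advance D)^[k] w)
      S.last.opp) (ToroidalGrid.step ((advance D)^[k] w) (D ((advance D)^[k] w)))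
      (D ((advance D)^[k] w)) := by
    rw [walkStep, hread, hS.pos]
  refine ⟨hpos, ?_, ?_, ?_, ?_⟩
  · intro s hs
    obtain rfl : s = k := by omega
    exact hread
  · intro s hs
    rw [hdirs, Function.update_of_ne (hne _ _)]
    rcases Nat.lt_or_ge (s + 1) k with h1 | h1
    · rw [Function.update_of_ne (hinj _ h1), hS.white s h1]
    · obtain rfl : s + 1 = k := by omega
      rw [Function.update_self, hS.last s rfl]
  · intro s hs
    rw [hdirs]
    rcases Nat.lt_or_ge s k with h1 | h1
    · rw [Function.update_of_ne (fun he => hinj s h1 (partner_injective hD he)),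
        Function.update_of_ne (hne k s).symm, hS.black s h1]
    · obtain rfl : s = k := by omega
      rw [Function.update_self]
  · intro u h1 h2
    rw [hdirs, Function.update_of_ne (h2 k (by omega)), Function.update_of_ne (h1 k (by omega))]
    exact hS.other u (fun s hs => h1 s (by omega)) fun s hs => h2 s (by omega)

/-- The walk is on its way back from the vertex where the orbit of `w` enters the cycle, and only
the vertices before its position do not yet have their final directions `F`. -/
structure WalkBack (D F : Vertex m n → Dir) (w : Vertex m n) (k : ℕ) (S : WalkState m n) :
    Prop where
  pos : S.pos = (advance D)^[k] w
  last : S.last.opp = F ((advance D)^[k] w)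
  white : ∀ s < k, S.dirs ((advance D)^[s + 1] w) = (D ((advance D)^[s] w)).opp
  other : ∀ u, (∀ s ≤ k, u ≠ (advance D)^[s] w) →
    (∀ s < k, u ≠ step ((advance D)^[s] w) (D ((advance D)^[s] w))) → S.dirs u = F u

/-- The directions after the shift along the cycle of the orbit. -/
structure FinalDirs (D F : Vertex m n → Dir) (w : Vertex m n) (t K : ℕ) : Prop where
  tail_white : ∀ s < t, F ((advance D)^[s] w) = D ((advance D)^[s] w)
  tail_black : ∀ s < t, F (step ((advance D)^[s] w) (D ((advance D)^[s] w))) =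
    (D ((advance D)^[s] w)).opp
  cycle_white : ∀ s, t ≤ s → s < K → F ((advance D)^[s + 1] w) = (D ((advance D)^[s] w)).opp
  cycle_black : ∀ s, t ≤ s → s < K →
    F (step ((advance D)^[s] w) (D ((advance D)^[s] w))) = D ((advance D)^[s] w)
  other : ∀ u, (∀ s < K, u ≠ (advance D)^[s] w) →
    (∀ s < K, u ≠ step ((advance D)^[s] w) (D ((advance D)^[s] w))) → F u = D u

theorem finalDirs_shiftCycle (hm : Even m) (hn : Even n) (hw : IsWhite w) (hD : IsPairing D)
    (h : IsRho (advance D) w t K) : FinalDirs D (shiftCycle D w) w t K := by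
  have hs := isShift_cycle hm hn hw h
  rw [shiftCycle_eq h]
  have hlt := h.lt
  have hmem : ∀ s, t ≤ s → s < K → (advance D)^[s] w ∈ cycleList (advance D) w t K :=
    fun s h1 h2 => mem_cycleList.2 ⟨s, h1, h2, rfl⟩
  have hnot : ∀ s < t, (advance D)^[s] w ∉ cycleList (advance D) w t K := by
    intro s h1 hmem
    obtain ⟨a, h2, h3, h4⟩ := mem_cycleList.1 hmem
    have := h.inj _ h3 _ (by omega) h4
    omega
  refine ⟨fun s hst => ?_, fun s hst => ?_, fun s h1 h2 => ?_, fun s h1 h2 => ?_, fun u h1 h2 => ?_⟩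
  · exact hs.shift_apply_white_of_notMem hm hn ((isWhite_iterate_advance hm hn D w s).2 hw)
      (hnot s hst)
  · rw [IsShift.shift_apply_other, hD]
    · intro hC
      exact (isWhite_step hm hn _ _).1 (hs.white _ hC) ((isWhite_iterate_advance hm hn D w s).2 hw)
    · rw [hD, step_step_opp]
      exact hnot s hst
  · rw [← hs.shift_apply_cycle (hmem s h1 h2), hs.apply_of_mem _ (hmem s h1 h2),
      Function.iterate_succ_apply']
  · exact hs.shift_apply_partner hm hn hD (hmem s h1 h2)
  · refine IsShift.shift_apply_other _ _ _ (fun hC => ?_) fun hC => ?_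
    · obtain ⟨s, -, hs1, hs2⟩ := mem_cycleList.1 hC
      exact h1 s hs1 hs2.symm
    · obtain ⟨s, -, hs1, hs2⟩ := mem_cycleList.1 hC
      apply h2 s hs1
      rw [hs2, hD, step_step_opp]

/-- At time `K` the walk is at the entrance of the cycle for the second time. Everything behind the
entrance already has its final direction; the entrance itself points back into the tail and receives
its final direction in the next write. -/
theorem WalkOut.walkBack {F : Vertex m n → Dir} (h : IsRho (advance D) w t K)
    (hF : FinalDirs D F w t K) {S : WalkState m n} (hS : WalkOut D w K S) :
    WalkBack D F w t S := by
  have hlt := h.lt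
  refine ⟨by rw [hS.pos, h.eq], ?_, fun s hs => hS.white s (by omega), fun u h1 h2 => ?_⟩
  · rw [hS.last (K - 1) (by omega), ← hF.cycle_white (K - 1) (by omega) (by omega),
      show K - 1 + 1 = K by omega, h.eq]
  · by_cases h3 : ∃ s < K, u = (advance D)^[s] w
    · obtain ⟨s, hs, rfl⟩ := h3
      have hts : t < s := by
        by_contra hle
        exact h1 s (by omega) rfl
      obtain ⟨r, rfl⟩ : ∃ r, s = r + 1 := ⟨s - 1, by omega⟩
      rw [hS.white r hs, hF.cycle_white r (by omega) (by omega)]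
    by_cases h4 : ∃ s < K, u = ToroidalGrid.step ((advance D)^[s] w) (D ((advance D)^[s] w))
    · obtain ⟨s, hs, rfl⟩ := h4
      have hts : t ≤ s := by
        by_contra hle
        exact h2 s (by omega) rfl
      rw [hS.black s hs, hF.cycle_black s hts hs]
    · push Not at h3 h4
      rw [hS.other u h3 h4, hF.other u h3 h4]

theorem WalkBack.step (hm : Even m) (hn : Even n) {F : Vertex m n → Dir}
    (h : IsRho (advance D) w t K)
    (hF : FinalDirs D F w t K) {k : ℕ} (hk : k < t) {S : WalkState m n}
    (hS : WalkBack D F w (k + 1) S) : WalkBack D F w k (walkStep S) := by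
  -- The outward pass has turned this vertex towards the partner of its predecessor, so the walk now
  -- retraces the tail.
  have hread : S.dirs S.pos = (D ((advance D)^[k] w)).opp := by
    rw [hS.pos]
    exact hS.white k (by omega)
  have hpos : S.pos = ToroidalGrid.step (ToroidalGrid.step ((advance D)^[k] w)
      (D ((advance D)^[k] w))) (D ((advance D)^[k] w)) := by
    rw [hS.pos, Function.iterate_succ_apply', advance]
  have hblack : ToroidalGrid.step S.pos (S.dirs S.pos) =
      ToroidalGrid.step ((advance D)^[k] w) (D ((advance D)^[k] w)) := by
    rw [hread, hpos, step_step_opp]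
  have hdirs : (walkStep S).dirs = Function.update (Function.update S.dirs
      ((advance D)^[k + 1] w) (F ((advance D)^[k + 1] w)))
      (ToroidalGrid.step ((advance D)^[k] w) (D ((advance D)^[k] w)))
      (D ((advance D)^[k] w)).opp := by
    rw [walkStep, hblack, hread, hS.last, hS.pos]
  have hlt := h.lt
  refine ⟨?_, ?_, fun s hs => ?_, fun u h1 h2 => ?_⟩
  · rw [walkStep, hblack, hread, step_step_opp]
  · rw [hF.tail_white k hk, walkStep, hread, Dir.opp_opp]
  · rw [hdirs]
    rw [Function.update_of_ne (iterate_ne_partner hm hn D w _ _), Function.update_of_ne,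
      hS.white s (by omega)]
    intro he
    have := h.inj _ (by omega) _ (by omega) he
    omega
  · rw [hdirs]
    by_cases hb : u = ToroidalGrid.step ((advance D)^[k] w) (D ((advance D)^[k] w))
    · rw [hb, Function.update_self, hF.tail_black k hk]
    rw [Function.update_of_ne hb]
    by_cases hu : u = (advance D)^[k + 1] w
    · rw [hu, Function.update_self]
    · rw [Function.update_of_ne hu]
      refine hS.other u (fun s hs => ?_) fun s hs => ?_
      · rcases Nat.lt_or_ge k s with h3 | h3
        · rwa [show s = k + 1 by omega]
        · exact h1 s h3
      · rcases Nat.lt_or_ge s k with h3 | h3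
        · exact h2 s h3
        · rwa [show s = k by omega]

/-- Back at the start, only the direction of `w` is pending; this is the write that accompanies
halting. -/
theorem WalkBack.update_eq {F : Vertex m n → Dir} {S : WalkState m n}
    (hS : WalkBack D F w 0 S) : Function.update S.dirs w S.last.opp = F := by
  funext u
  by_cases hu : u = w
  · rw [hu, Function.update_self, hS.last, Function.iterate_zero, id]
  · rw [Function.update_of_ne hu]
    refine hS.other u (fun s hs => ?_) fun s hs => absurd hs (Nat.not_lt_zero s)
    obtain rfl : s = 0 := by omega
    exact hu

/-- The walk returns to its start after a linear number of steps and performs the shift. -/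
theorem exists_walk (hm : Even m) (hn : Even n) (hw : IsWhite w) (hD : IsPairing D) :
    ∃ k, 0 < k ∧ k ≤ 2 * (m * n) ∧
      (∀ i, 0 < i → i < k → (walkStep^[i] (walkStart D w)).pos ≠ w) ∧
      (walkStep^[k] (walkStart D w)).pos = w ∧
      Function.update (walkStep^[k] (walkStart D w)).dirs w
        (walkStep^[k] (walkStart D w)).last.opp = shiftCycle D w := by
  obtain ⟨t, K, h⟩ := exists_isRho (advance D) w
  have hF := finalDirs_shiftCycle hm hn hw hD h
  have hlt := h.lt
  have hK : K ≤ m * n := by simpa using h.le_card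
  have out : ∀ k ≤ K, WalkOut D w k (walkStep^[k] (walkStart D w)) := by
    intro k
    induction k with
    | zero => exact fun _ => walkOut_start
    | succ k ih =>
      intro hk
      rw [Function.iterate_succ_apply']
      exact (ih (by omega)).step hm hn hD h (by omega)
  have back : ∀ r ≤ t, WalkBack D (shiftCycle D w) w (t - r) (walkStep^[K + r] (walkStart D w)) := by
    intro r
    induction r with
    | zero => exact fun _ => (out K le_rfl).walkBack h hF
    | succ r ih =>
      intro hr
      rw [← Nat.add_assoc, Function.iterate_succ_apply']
      have h1 := ih (by omega)
      rw [show t - r = t - (r + 1) + 1 by omega] at h1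
      exact h1.step hm hn h hF (by omega)
  have hend := back t le_rfl
  rw [Nat.sub_self] at hend
  -- `K` steps lead out to the second visit of the entrance, and `t` steps lead back along the tail.
  refine ⟨K + t, by omega, by omega, fun i h0 hi => ?_, hend.pos, hend.update_eq⟩
  rcases Nat.lt_or_ge i K with h1 | h1
  · rw [(out i h1.le).pos]
    intro he
    have := h.inj i h1 0 (by omega) he
    omega
  · have h2 := (back (i - K) (by omega)).pos
    rw [Nat.add_sub_cancel' h1] at h2
    rw [h2]
    intro he
    have := h.inj _ (by omega) 0 (by omega) he
    omega

end Walk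

/-! ### A stack machine for the walk -/

open Turing

/-- The stackFn of the machine: the tape to the left and to the right of the head, and a counter. -/
inductive Stk : Type
  | left
  | right
  | count
  deriving DecidableEq

instance : Fintype Stk := ⟨{.left, .right, .count}, fun k => by cases k <;> simp⟩

/-- The labels of the machine. -/
inductive Label : Type
  | start
  | arrive
  | east
  | west
  | westSeek
  | home
  | measure
  | skipRow
  | wrapDown
  | rewind
  | wrapUp
  | unwind
  | rowUp
  | restore
  deriving DecidableEq

instance : Fintype Label :=
  ⟨{.start, .arrive, .east, .west, .westSeek, .home, .measure, .skipRow, .wrapDown, .rewind,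
    .wrapUp, .unwind, .rowUp, .restore}, fun l => by cases l <;> simp⟩

/-- The registers: the symbol read last, the direction of the walk, and whether the walk goes
towards a white vertex. -/
abbrev Reg : Type := Option Symbol × Dir × Bool

/-- The program statements of the machine. -/
abbrev Code : Type := TM2.Stmt (fun _ : Stk => Symbol) Label Reg

/-- The symbol of a vertex. -/
def Dir.symbol (d : Dir) : Symbol :=
  some (decide (d = .east), decide (d = .west), decide (d = .south), decide (d = .north))

/-- The direction encoded by a symbol. -/
def dirOfSymbol : Option Symbol → Dir
  | some (some (true, _, _, _)) => .east
  | some (some (_, true, _, _)) => .west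
  | some (some (_, _, true, _)) => .south
  | _ => .north

theorem dirOfSymbol_symbol (d : Dir) : dirOfSymbol (some d.symbol) = d := by
  cases d <;> rfl

namespace Code

/-- Read the top of a stack. -/
def look (k : Stk) : Code → Code := TM2.Stmt.peek k fun r o => (o, r.2)

/-- Read and remove the top of a stack. -/
def take (k : Stk) : Code → Code := TM2.Stmt.pop k fun r o => (o, r.2)

/-- Push the symbol read last. -/
def put (k : Stk) : Code → Code := TM2.Stmt.push k fun r => r.1.getD none

/-- Increase the counter. -/
def tick : Code → Code := TM2.Stmt.push .count fun _ => none

/-- Push the symbol of a direction. -/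
def write (f : Dir → Dir) : Code → Code := TM2.Stmt.push .right fun r => (f r.2.1).symbol

/-- Continue at a label. -/
def jump (l : Label) : Code := TM2.Stmt.load (fun r => (none, r.2)) (TM2.Stmt.goto fun _ => l)

/-- Branch on whether the stack read last was empty. -/
def ifEmpty : Code → Code → Code := TM2.Stmt.branch fun r => decide (r.1 = none)

/-- Branch on whether the symbol read last was the end mark of a row. -/
def ifMark : Code → Code → Code := TM2.Stmt.branch fun r => decide (r.1 = some none)

/-- Branch on whether the head was at the start of a row. -/
def ifStart : Code → Code → Code := TM2.Stmt.branch fun r => decide (r.1.getD none = none)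

/-- The label at which the motion in a direction starts. -/
def moveLabel : Dir → Label
  | .east => .east
  | .west => .west
  | .south => .measure
  | .north => .measure

/-- Set the registers and start moving. -/
def move (f : Option Symbol → Dir → Dir) (half : Bool) : Code :=
  TM2.Stmt.load (fun r => (none, f r.1 r.2.1, half)) (TM2.Stmt.goto fun r => moveLabel r.2.1)

end Code

open Code

/-- The program of the machine. -/
def program : Label → Code
  | .start => look .right (move (fun o _ => dirOfSymbol o) false)
  -- At a white vertex an empty left stack identifies the corner, where the walk ends. At a black
  -- vertex the direction of the walk is written and kept.
  | .arrive => TM2.Stmt.branch (fun r => r.2.2)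
      (look .left (ifEmpty
        (take .right (write Dir.opp (TM2.Stmt.load (fun _ => (none, .east, false)) TM2.Stmt.halt)))
        (take .right (write Dir.opp (move (fun o _ => dirOfSymbol o) false)))))
      (take .right (write id (move (fun _ d => d) true)))
  | .east => take .right (put .left (look .right (ifMark (jump .home) (jump .arrive))))
  | .west => look .left (ifStart (jump .westSeek) (take .left (put .right (jump .arrive))))
  | .westSeek => look .right (ifMark (take .left (put .right (jump .arrive)))
      (take .right (put .left (jump .westSeek))))
  | .home => look .left (ifStart (jump .restore) (take .left (put .right (jump .home))))
  -- Going back to the start of the row stores the column in the counter; `restore` uses it to find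
  -- the same column in another row.
  | .measure => look .left (ifStart
      (TM2.Stmt.branch (fun r => decide (r.2.1 = .south)) (jump .skipRow) (jump .wrapUp))
      (take .left (put .right (tick (jump .measure)))))
  | .skipRow => take .right (put .left (ifMark (jump .wrapDown) (jump .skipRow)))
  | .wrapDown => look .right (ifEmpty (jump .rewind) (jump .restore))
  | .rewind => take .left (ifEmpty (jump .restore) (put .right (jump .rewind)))
  | .wrapUp => look .left (ifEmpty (jump .unwind) (jump .rowUp))
  | .unwind => take .right (ifEmpty (jump .rowUp) (put .left (jump .unwind)))
  | .rowUp => take .left (put .right (jump .home))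
  | .restore => take .count (ifEmpty (jump .arrive) (take .right (put .left (jump .restore))))

/-- The configurations of the machine. -/
abbrev Conf : Type := TM2.Cfg (fun _ : Stk => Symbol) Label Reg

/-- The contents of the three stackFn. -/
def stackFn (a b c : List Symbol) : Stk → List Symbol
  | .left => a
  | .right => b
  | .count => c

section

variable (a b c x : List Symbol)

@[simp] theorem stackFn_left : stackFn a b c .left = a := rfl
@[simp] theorem stackFn_right : stackFn a b c .right = b := rfl
@[simp] theorem stackFn_count : stackFn a b c .count = c := rfl

@[simp] theorem update_stackFn_left :
    Function.update (stackFn a b c) .left x = stackFn x b c := by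
  funext k; cases k <;> rfl

@[simp] theorem update_stackFn_right :
    Function.update (stackFn a b c) .right x = stackFn a x c := by
  funext k; cases k <;> rfl

@[simp] theorem update_stackFn_count :
    Function.update (stackFn a b c) .count x = stackFn a b x := by
  funext k; cases k <;> rfl

end

/-! ### Running times of the loops and moves -/

/-- The part of the tape to the left of position `p`. -/
def leftPart (τ : ℕ → Symbol) (p : ℕ) : List Symbol := ((List.range p).map τ).reverse

/-- The `k` symbols of the tape from position `p` on. -/
def rightPart (τ : ℕ → Symbol) (p k : ℕ) : List Symbol := (List.range' p k).map τ

@[simp] theorem leftPart_zero (τ : ℕ → Symbol) : leftPart τ 0 = [] := rfl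

@[simp] theorem leftPart_succ (τ : ℕ → Symbol) (p : ℕ) :
    leftPart τ (p + 1) = τ p :: leftPart τ p := by
  simp [leftPart, List.range_succ]

@[simp] theorem rightPart_zero (τ : ℕ → Symbol) (p : ℕ) : rightPart τ p 0 = [] := rfl

@[simp] theorem rightPart_succ (τ : ℕ → Symbol) (p k : ℕ) :
    rightPart τ p (k + 1) = τ p :: rightPart τ (p + 1) k := by
  simp [rightPart, List.range'_succ]

/-- The configuration of the machine at a label: the head is at position `p`, there are `k` symbols
from there on, and the counter is `c`. -/
def conf (l : Label) (d : Dir) (half : Bool) (τ : ℕ → Symbol) (p k c : ℕ) : Conf :=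
  ⟨some l, (none, d, half), stackFn (leftPart τ p) (rightPart τ p k) (List.replicate c none)⟩

/-- The machine gets from one configuration to another in at most the given number of steps. -/
def RunsIn (t : ℕ) (x y : Conf) : Prop :=
  ∃ s ≤ t, (flip bind (TM2.step program))^[s] (some x) = some y

theorem RunsIn.refl (t : ℕ) (x : Conf) : RunsIn t x x := ⟨0, Nat.zero_le _, rfl⟩

theorem RunsIn.trans {s t : ℕ} {x y z : Conf} (h : RunsIn s x y) (h' : RunsIn t y z) :
    RunsIn (s + t) x z := by
  obtain ⟨a, ha, hxy⟩ := h
  obtain ⟨b, hb, hyz⟩ := h'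
  exact ⟨b + a, by omega, by rw [Function.iterate_add_apply, hxy, hyz]⟩

theorem RunsIn.mono {s t : ℕ} {x y : Conf} (h : RunsIn s x y) (hst : s ≤ t) :
    RunsIn t x y := by
  obtain ⟨a, ha, hxy⟩ := h
  exact ⟨a, by omega, hxy⟩

theorem RunsIn.single {x y : Conf} (h : (TM2.step program) x = some y) : RunsIn 1 x y :=
  ⟨1, le_rfl, h⟩

theorem RunsIn.cons {t : ℕ} {x y z : Conf} (h : (TM2.step program) x = some y)
    (h' : RunsIn t y z) : RunsIn (t + 1) x z := by
  rw [Nat.add_comm]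
  exact (RunsIn.single h).trans h'

/-- The position is the start of a row. -/
def AtStart (τ : ℕ → Symbol) (q : ℕ) : Prop := ∀ p, p + 1 = q → τ p = none

section Loops

variable (d : Dir) (half : Bool) (τ : ℕ → Symbol)

theorem runs_home {q : ℕ} (hq : AtStart τ q) (c : ℕ) :
    ∀ j k, (∀ i < j, τ (q + i) ≠ none) →
      RunsIn (j + 1) (conf .home d half τ (q + j) k c) (conf .restore d half τ q (k + j) c) := by
  intro j
  induction j with
  | zero =>
    intro k _
    refine RunsIn.single ?_
    cases q with
    | zero => simp [conf, program, look, take, put, ifStart, jump]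
    | succ q => simp [conf, program, look, take, put, ifStart, jump, hq q rfl]
  | succ j ih =>
    intro k h
    have h1 := ih (k + 1) fun i hi => h i (by omega)
    rw [show k + 1 + j = k + (j + 1) by omega] at h1
    refine RunsIn.cons ?_ h1
    simp [conf, program, look, take, put, ifStart, jump, ← Nat.add_assoc, h j (by omega)]

theorem runs_measure {q : ℕ} (hq : AtStart τ q) :
    ∀ j k c, (∀ i < j, τ (q + i) ≠ none) →
      RunsIn (j + 1) (conf .measure d half τ (q + j) k c)
        (conf (if d = .south then .skipRow else .wrapUp) d half τ q (k + j) (c + j)) := by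
  intro j
  induction j with
  | zero =>
    intro k c _
    refine RunsIn.single ?_
    cases q with
    | zero => by_cases hd : d = .south <;>
        simp [conf, program, look, take, put, tick, ifStart, jump, hd]
    | succ q => by_cases hd : d = .south <;>
        simp [conf, program, look, take, put, tick, ifStart, jump, hq q rfl, hd]
  | succ j ih =>
    intro k c h
    have h1 := ih (k + 1) (c + 1) fun i hi => h i (by omega)
    rw [show k + 1 + j = k + (j + 1) by omega, show c + 1 + j = c + (j + 1) by omega] at h1
    refine RunsIn.cons ?_ h1
    simp [conf, program, look, take, put, tick, ifStart, jump, ← Nat.add_assoc, h j (by omega),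
      List.replicate_succ]

theorem runs_skipRow (c : ℕ) :
    ∀ j p k, (∀ i < j, τ (p + i) ≠ none) → τ (p + j) = none →
      RunsIn (j + 1) (conf .skipRow d half τ p (k + j + 1) c)
        (conf .wrapDown d half τ (p + j + 1) k c) := by
  intro j
  induction j with
  | zero =>
    intro p k _ h
    refine RunsIn.single ?_
    simp [conf, program, take, put, ifMark, jump, show τ p = none from h]
  | succ j ih =>
    intro p k h h0
    have h1 := ih (p + 1) k (fun i hi => by
      have := h (i + 1) (by omega)
      rwa [show p + (i + 1) = p + 1 + i by omega] at this)
      (by rwa [show p + 1 + j = p + (j + 1) by omega])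
    rw [show p + 1 + j + 1 = p + (j + 1) + 1 by omega] at h1
    refine RunsIn.cons ?_ h1
    simp [conf, program, take, put, ifMark, jump, ← Nat.add_assoc,
      show τ p ≠ none from h 0 (by omega)]

/-- The last cell of a row is recognised only by the end mark behind it, so the head moves onto the
mark and then one cell back. -/
theorem runs_westSeek (c : ℕ) :
    ∀ j p k, (∀ i < j + 1, τ (p + i) ≠ none) → τ (p + j + 1) = none →
      RunsIn (j + 2) (conf .westSeek d half τ p (k + j + 2) c)
        (conf .arrive d half τ (p + j) (k + 2) c) := by
  intro j
  induction j with
  | zero =>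
    intro p k h h0
    have h2 : TM2.step program (conf .westSeek d half τ (p + 1) (k + 1) c) =
        some (conf .arrive d half τ p (k + 2) c) := by
      simp [conf, program, look, take, put, ifMark, jump, show τ (p + 1) = none from h0]
    refine RunsIn.cons ?_ (RunsIn.single h2)
    simp [conf, program, look, take, put, ifMark, jump, show τ p ≠ none from h 0 (by omega)]
  | succ j ih =>
    intro p k h h0
    have h1 := ih (p + 1) k (fun i hi => by
      have := h (i + 1) (by omega)
      rwa [show p + (i + 1) = p + 1 + i by omega] at this)
      (by rwa [show p + 1 + j + 1 = p + (j + 1) + 1 by omega])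
    rw [show p + 1 + j = p + (j + 1) by omega] at h1
    refine RunsIn.cons ?_ h1
    simp [conf, program, look, take, put, ifMark, jump, ← Nat.add_assoc,
      show τ p ≠ none from h 0 (by omega)]

theorem runs_rewind (c : ℕ) :
    ∀ p k, RunsIn (p + 1) (conf .rewind d half τ p k c) (conf .restore d half τ 0 (k + p) c) := by
  intro p
  induction p with
  | zero =>
    intro k
    refine RunsIn.single ?_
    simp [conf, program, take, put, ifEmpty, jump]
  | succ p ih =>
    intro k
    have h1 := ih (k + 1)
    rw [show k + 1 + p = k + (p + 1) by omega] at h1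
    refine RunsIn.cons ?_ h1
    simp [conf, program, take, put, ifEmpty, jump]

theorem runs_unwind (c : ℕ) :
    ∀ k p, RunsIn (k + 1) (conf .unwind d half τ p k c) (conf .rowUp d half τ (p + k) 0 c) := by
  intro k
  induction k with
  | zero =>
    intro p
    refine RunsIn.single ?_
    simp [conf, program, take, put, ifEmpty, jump]
  | succ k ih =>
    intro p
    have h1 := ih (p + 1)
    rw [show p + 1 + k = p + (k + 1) by omega] at h1
    refine RunsIn.cons ?_ h1
    simp [conf, program, take, put, ifEmpty, jump]

theorem runs_restore :
    ∀ c p k, RunsIn (c + 1) (conf .restore d half τ p (k + c) c)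
      (conf .arrive d half τ (p + c) k 0) := by
  intro c
  induction c with
  | zero =>
    intro p k
    refine RunsIn.single ?_
    simp [conf, program, take, put, ifEmpty, jump]
  | succ c ih =>
    intro p k
    have h1 := ih (p + 1) k
    rw [show p + 1 + c = p + (c + 1) by omega] at h1
    refine RunsIn.cons ?_ h1
    simp [conf, program, take, put, ifEmpty, jump, ← Nat.add_assoc, List.replicate_succ]

end Loops

section Moves

variable (half : Bool) {τ : ℕ → Symbol} {n q : ℕ} (hq : AtStart τ q)
  (hrow : ∀ i < n, τ (q + i) ≠ none) (hend : τ (q + n) = none)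

include hrow in
theorem runs_east {j k : ℕ} (hj : j + 1 < n) :
    RunsIn 1 (conf .east .east half τ (q + j) (k + 2) 0)
      (conf .arrive .east half τ (q + (j + 1)) (k + 1) 0) := by
  refine RunsIn.single ?_
  simp [conf, program, take, put, look, ifMark, jump, ← Nat.add_assoc,
    show τ (q + j + 1) ≠ none from hrow _ hj]

include hq hrow hend in
theorem runs_east_wrap {j k : ℕ} (hj : j + 1 = n) :
    RunsIn (n + 3) (conf .east .east half τ (q + j) (k + 2) 0)
      (conf .arrive .east half τ q (k + 2 + j) 0) := by
  have h1 := runs_home .east half τ hq 0 (j + 1) (k + 1) fun i hi => hrow i (by omega)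
  rw [show k + 1 + (j + 1) = k + 2 + j by omega] at h1
  refine (RunsIn.cons ?_ (h1.trans (runs_restore .east half τ 0 q (k + 2 + j)))).mono (by omega)
  simp [conf, program, take, put, look, ifMark, jump, ← Nat.add_assoc,
    show τ (q + j + 1) = none by rw [Nat.add_assoc, hj]; exact hend]

include hrow in
theorem runs_west {j k : ℕ} (hj : j + 1 < n) :
    RunsIn 1 (conf .west .west half τ (q + (j + 1)) k 0)
      (conf .arrive .west half τ (q + j) (k + 1) 0) := by
  refine RunsIn.single ?_
  simp [conf, program, take, put, look, ifStart, jump, ← Nat.add_assoc, hrow j (by omega)]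

include hq hrow hend in
theorem runs_west_wrap {j k : ℕ} (hj : j + 1 = n) :
    RunsIn (n + 2) (conf .west .west half τ q (k + 2 + j) 0)
      (conf .arrive .west half τ (q + j) (k + 2) 0) := by
  have h1 := runs_westSeek .west half τ 0 j q k (fun i hi => hrow i (by omega))
    (by rw [Nat.add_assoc, hj]; exact hend)
  refine (RunsIn.cons ?_ h1).mono (show j + 2 + 1 ≤ n + 2 by omega)
  rw [show k + j + 2 = k + 2 + j by omega]
  cases q with
  | zero => simp [conf, program, look, take, put, ifStart, jump]
  | succ q => simp [conf, program, look, take, put, ifStart, jump, hq q rfl]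

include hq hrow hend in
theorem runs_skipRow_south {j k : ℕ} (hj : j < n) :
    RunsIn (2 * n + 2) (conf .measure .south half τ (q + j) (k + (n - j) + 1) 0)
      (conf .wrapDown .south half τ (q + n + 1) k j) := by
  have h1 := runs_measure .south half τ hq j (k + (n - j) + 1) 0 fun i hi => hrow i (by omega)
  have h2 := runs_skipRow .south half τ j n q k hrow hend
  rw [if_pos rfl, Nat.zero_add, show k + (n - j) + 1 + j = k + n + 1 by omega] at h1
  exact (h1.trans h2).mono (by omega)

include hq hrow hend in
theorem runs_south {j k : ℕ} (hj : j < n) :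
    RunsIn (3 * n + 4) (conf .measure .south half τ (q + j) (k + j + 1 + (n - j) + 1) 0)
      (conf .arrive .south half τ (q + n + 1 + j) (k + 1) 0) := by
  have h1 := runs_skipRow_south half hq hrow hend (k := k + j + 1) hj
  have h2 := runs_restore .south half τ j (q + n + 1) (k + 1)
  rw [show k + 1 + j = k + j + 1 by omega] at h2
  refine (h1.trans (RunsIn.cons ?_ h2)).mono (by omega)
  simp [conf, program, look, ifEmpty, jump]

include hq hrow hend in
-- An empty right stack behind the end mark shows that this was the last row; the whole tape is then
-- rewound before the column is restored.
theorem runs_south_wrap {j : ℕ} (hj : j < n) :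
    RunsIn (3 * n + q + n + 6) (conf .measure .south half τ (q + j) (n - j + 1) 0)
      (conf .arrive .south half τ j (q + n + 1 - j) 0) := by
  have h1 := runs_skipRow_south half hq hrow hend (k := 0) hj
  have h2 := runs_rewind .south half τ j (q + n + 1) 0
  have h3 := runs_restore .south half τ j 0 (q + n + 1 - j)
  rw [Nat.zero_add] at h1 h2 h3
  rw [show q + n + 1 - j + j = q + n + 1 by omega] at h3
  refine (h1.trans (RunsIn.cons ?_ (h2.trans h3))).mono (by omega)
  simp [conf, program, look, ifEmpty, jump]

include hrow hq in
theorem runs_rowUp {j k : ℕ} (hj : j < n) :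
    RunsIn (2 * n + 4) (conf .rowUp .north half τ (q + n + 1) k j)
      (conf .arrive .north half τ (q + j) (k + n + 1 - j) 0) := by
  have h1 := runs_home .north half τ hq j n (k + 1) hrow
  have h2 := runs_restore .north half τ j q (k + n + 1 - j)
  rw [show k + n + 1 - j + j = k + 1 + n by omega] at h2
  refine (RunsIn.cons ?_ (h1.trans h2)).mono (show n + 1 + (j + 1) + 1 ≤ _ by omega)
  simp [conf, program, take, put, jump]

include hrow hend hq in
theorem runs_north {j k : ℕ} (hj : j < n) (hrow' : ∀ i < n, τ (q + n + 1 + i) ≠ none) :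
    RunsIn (3 * n + 6) (conf .measure .north half τ (q + n + 1 + j) k 0)
      (conf .arrive .north half τ (q + j) (k + j + n + 1 - j) 0) := by
  have h1 := runs_measure .north half τ (q := q + n + 1)
    (fun p hp => by rw [show p = q + n by omega, hend]) j k 0 fun i hi => hrow' i (by omega)
  rw [if_neg (by decide), Nat.zero_add] at h1
  have h2 := runs_rowUp half hq hrow (k := k + j) hj
  refine (h1.trans (RunsIn.cons ?_ h2)).mono (by omega)
  simp [conf, program, look, ifEmpty, jump]

include hrow hq in
-- In the first row nothing lies to the left of the row start; the head runs to the end of the tape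
-- and enters the last row from behind its end mark.
theorem runs_north_wrap {j k : ℕ} (hj : j < n) (hrow' : ∀ i < n, τ i ≠ none)
    (hk : k + j = q + n + 1) :
    RunsIn (4 * n + q + 10) (conf .measure .north half τ j k 0)
      (conf .arrive .north half τ (q + j) (n + 1 - j) 0) := by
  have h1 := runs_measure .north half τ (q := 0)
    (fun p hp => by omega) j k 0 fun i hi => by rw [Nat.zero_add]; exact hrow' i (by omega)
  rw [if_neg (by decide), Nat.zero_add, hk] at h1
  have h2 := runs_unwind .north half τ j (q + n + 1) 0
  have h3 := runs_rowUp half hq hrow (k := 0) hj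
  rw [Nat.zero_add] at h2 h3
  refine (h1.trans (RunsIn.cons ?_ (h2.trans h3))).mono (by omega)
  simp [conf, program, look, ifEmpty, jump]

end Moves

/-! ### The grid on the tape -/

/-- The tape describing a choice of directions. -/
def word (D : Vertex m n → Dir) (p : ℕ) : Symbol :=
  if h : p / (n + 1) < m ∧ p % (n + 1) < n then
    (D (⟨p / (n + 1), h.1⟩, ⟨p % (n + 1), h.2⟩)).symbol
  else none

/-- The position of a vertex on the tape. -/
def tapePos (u : Vertex m n) : ℕ := u.1.val * (n + 1) + u.2.val

theorem row_div {i j : ℕ} (hj : j ≤ n) : (i * (n + 1) + j) / (n + 1) = i := by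
  rw [Nat.add_comm, Nat.add_mul_div_right _ _ (by omega), Nat.div_eq_of_lt (by omega), zero_add]

theorem row_mod {i j : ℕ} (hj : j ≤ n) : (i * (n + 1) + j) % (n + 1) = j := by
  rw [Nat.add_comm, Nat.add_mul_mod_self_right, Nat.mod_eq_of_lt (by omega)]

theorem word_tapePos (D : Vertex m n → Dir) (u : Vertex m n) :
    word D (tapePos u) = (D u).symbol := by
  obtain ⟨⟨i, hi⟩, ⟨j, hj⟩⟩ := u
  have h1 := row_div (i := i) hj.le
  have h2 := row_mod (i := i) hj.le
  simp only [word, tapePos, h1, h2, hi, hj, and_self, dif_pos]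

theorem word_cell (D : Vertex m n → Dir) {i : ℕ} (hi : i < m) :
    ∀ j < n, word D (i * (n + 1) + j) ≠ none := by
  intro j hj
  have := word_tapePos D (⟨i, hi⟩, ⟨j, hj⟩)
  simp only [tapePos] at this
  simp [this, Dir.symbol]

theorem word_end (D : Vertex m n → Dir) (i : ℕ) : word D (i * (n + 1) + n) = none := by
  rw [word, dif_neg]
  rw [row_mod le_rfl]
  omega

theorem atStart_word (D : Vertex m n → Dir) (i : ℕ) : AtStart (word D) (i * (n + 1)) := by
  intro p hp
  cases i with
  | zero => omega
  | succ i =>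
    rw [Nat.succ_mul] at hp
    rw [show p = i * (n + 1) + n by omega, word_end]

theorem tapePos_injective : Function.Injective (tapePos (m := m) (n := n)) := by
  intro u v h
  simp only [tapePos] at h
  have h1 := congrArg (· / (n + 1)) h
  have h2 := congrArg (· % (n + 1)) h
  simp only [row_div u.2.isLt.le, row_div v.2.isLt.le] at h1
  simp only [row_mod u.2.isLt.le, row_mod v.2.isLt.le] at h2
  exact Prod.ext (Fin.ext h1) (Fin.ext h2)

theorem tapePos_lt (u : Vertex m n) : tapePos u < m * (n + 1) := by
  have h1 := u.2.isLt
  have h2 := Nat.mul_le_mul_right (n + 1) u.1.isLt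
  rw [Nat.succ_mul] at h2
  simp only [tapePos]
  omega

theorem word_update (D : Vertex m n → Dir) (u : Vertex m n) (d : Dir) :
    word (Function.update D u d) = Function.update (word D) (tapePos u) d.symbol := by
  funext p
  by_cases hp : p = tapePos u
  · rw [hp, Function.update_self, word_tapePos, Function.update_self]
  · rw [Function.update_of_ne hp]
    by_cases h : p / (n + 1) < m ∧ p % (n + 1) < n
    · rw [word, word, dif_pos h, dif_pos h, Function.update_of_ne]
      rintro rfl
      apply hp
      simp only [tapePos]
      rw [Nat.mul_comm, Nat.div_add_mod]
    · rw [word, word, dif_neg h, dif_neg h]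

theorem leftPart_update (τ : ℕ → Symbol) (p : ℕ) (a : Symbol) :
    leftPart (Function.update τ p a) p = leftPart τ p := by
  simp only [leftPart]
  congr 1
  refine List.map_congr_left fun q hq => Function.update_of_ne ?_ _ _
  rw [List.mem_range] at hq
  exact hq.ne

theorem rightPart_update (τ : ℕ → Symbol) (p k : ℕ) (a : Symbol) :
    rightPart (Function.update τ p a) (p + 1) k = rightPart τ (p + 1) k := by
  refine List.map_congr_left fun q hq => Function.update_of_ne ?_ _ _
  rw [List.mem_range'_1] at hq
  omega

/-- The configuration of the machine with the head at a vertex. -/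
def vertexConf (l : Label) (d : Dir) (half : Bool) (D : Vertex m n → Dir) (u : Vertex m n) : Conf :=
  conf l d half (word D) (tapePos u) (m * (n + 1) - tapePos u) 0

theorem vertexConf_eq (l : Label) (d : Dir) (half : Bool) (D : Vertex m n → Dir) {u : Vertex m n}
    {p k : ℕ} (hp : tapePos u = p) (hk : p + k = m * (n + 1)) :
    vertexConf l d half D u = conf l d half (word D) p k 0 := by
  rw [vertexConf, hp, show m * (n + 1) - p = k by omega]

/-- A bound for the time of a single move. -/
def moveTime (m n : ℕ) : ℕ := 5 * (m * (n + 1)) + 10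

theorem runs_move (d : Dir) (half : Bool) (D : Vertex m n → Dir) (u : Vertex m n) :
    RunsIn (moveTime m n) (vertexConf (moveLabel d) d half D u)
      (vertexConf .arrive d half D (step u d)) := by
  obtain ⟨⟨i, hi⟩, ⟨j, hj⟩⟩ := u
  have hrow := word_cell D hi
  have hend := word_end D i
  have hq := atStart_word D i
  have hN : i * (n + 1) + (n + 1) ≤ m * (n + 1) := by
    have := Nat.mul_le_mul_right (n + 1) (Nat.succ_le_of_lt hi)
    rwa [Nat.succ_mul] at this
  have hpos : tapePos (⟨⟨i, hi⟩, ⟨j, hj⟩⟩ : Vertex m n) = i * (n + 1) + j := rfl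
  -- The constants are generous: every move is a bounded number of passes over a row, plus at most
  -- one pass over the tape when it wraps vertically.
  simp only [moveTime]
  cases d with
  | east =>
    by_cases hw : j + 1 = n
    · have h := runs_east_wrap half hq hrow hend (k := m * (n + 1) - (i * (n + 1) + j) - 2) hw
      rw [vertexConf_eq _ _ _ _ hpos (k := m * (n + 1) - (i * (n + 1) + j) - 2 + 2) (by omega),
        vertexConf_eq (p := i * (n + 1)) _ _ _ _ (by simp [tapePos, step, val_next, hw])
          (k := m * (n + 1) - (i * (n + 1) + j) - 2 + 2 + j) (by omega)]
      exact h.mono (by omega)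
    · have h := runs_east half hrow (j := j) (k := m * (n + 1) - (i * (n + 1) + j) - 2) (by omega)
      rw [vertexConf_eq _ _ _ _ hpos (k := m * (n + 1) - (i * (n + 1) + j) - 2 + 2) (by omega),
        vertexConf_eq (p := i * (n + 1) + (j + 1)) _ _ _ _ (by simp [tapePos, step, val_next, hw])
          (k := m * (n + 1) - (i * (n + 1) + j) - 2 + 1) (by omega)]
      exact h.mono (by omega)
  | west =>
    cases j with
    | zero =>
      have h := runs_west_wrap half hq hrow hend (j := n - 1)
        (k := m * (n + 1) - (i * (n + 1)) - 2 - (n - 1)) (by omega)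
      rw [vertexConf_eq (p := i * (n + 1)) _ _ _ _ hpos
          (k := m * (n + 1) - (i * (n + 1)) - 2 - (n - 1) + 2 + (n - 1)) (by omega),
        vertexConf_eq (p := i * (n + 1) + (n - 1)) _ _ _ _ (by simp [tapePos, step, val_prev])
          (k := m * (n + 1) - (i * (n + 1)) - 2 - (n - 1) + 2) (by omega)]
      exact h.mono (by omega)
    | succ j =>
      have h := runs_west half hrow (j := j) (k := m * (n + 1) - (i * (n + 1) + (j + 1))) hj
      rw [vertexConf_eq _ _ _ _ hpos (k := m * (n + 1) - (i * (n + 1) + (j + 1))) (by omega),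
        vertexConf_eq (p := i * (n + 1) + j) _ _ _ _ (by simp [tapePos, step, val_prev])
          (k := m * (n + 1) - (i * (n + 1) + (j + 1)) + 1) (by omega)]
      exact h.mono (by omega)
  | south =>
    by_cases hw : i + 1 = m
    · have hN' : i * (n + 1) + (n + 1) = m * (n + 1) := by rw [← hw, Nat.succ_mul]
      have h := runs_south_wrap half hq hrow hend hj
      rw [vertexConf_eq _ _ _ _ hpos (k := n - j + 1) (by omega),
        vertexConf_eq (p := j) _ _ _ _ (by simp [tapePos, step, val_next, hw])
          (k := i * (n + 1) + n + 1 - j) (by omega)]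
      exact h.mono (by omega)
    · have hN' : i * (n + 1) + (n + 1) + (n + 1) ≤ m * (n + 1) := by
        have := Nat.mul_le_mul_right (n + 1) (show i + 1 + 1 ≤ m by omega)
        rwa [Nat.succ_mul, Nat.succ_mul] at this
      have h := runs_south half hq hrow hend hj
        (k := m * (n + 1) - (i * (n + 1) + n + 1 + j) - 1)
      rw [vertexConf_eq _ _ _ _ hpos
          (k := m * (n + 1) - (i * (n + 1) + n + 1 + j) - 1 + j + 1 + (n - j) + 1) (by omega),
        vertexConf_eq (p := i * (n + 1) + n + 1 + j) _ _ _ _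
          (by simp only [tapePos, step, val_next, hw, if_false]; rw [Nat.succ_mul]; omega)
          (k := m * (n + 1) - (i * (n + 1) + n + 1 + j) - 1 + 1) (by omega)]
      exact h.mono (by omega)
  | north =>
    cases i with
    | zero =>
      obtain ⟨m, rfl⟩ : ∃ m', m = m' + 1 := ⟨m - 1, by omega⟩
      have hN' : m * (n + 1) + (n + 1) = (m + 1) * (n + 1) := by rw [Nat.succ_mul]
      have h := runs_north_wrap half (atStart_word D m) (word_cell D (Nat.lt_succ_self m)) hj
        (fun i hi => by simpa using hrow i hi) (k := (m + 1) * (n + 1) - j) (by omega)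
      rw [vertexConf_eq (p := j) _ _ _ _ (by simp [tapePos]) (k := (m + 1) * (n + 1) - j)
          (by omega),
        vertexConf_eq (p := m * (n + 1) + j) _ _ _ _ (by simp [tapePos, step, val_prev])
          (k := n + 1 - j) (by omega)]
      exact h.mono (by omega)
    | succ i =>
      have h := runs_north half (atStart_word D i) (word_cell D (show i < m by omega))
        (word_end D i) hj (k := m * (n + 1) - ((i + 1) * (n + 1) + j))
        (fun a ha => by
          have := hrow a ha
          rwa [Nat.succ_mul, ← Nat.add_assoc] at this)
      have hS : (i + 1) * (n + 1) = i * (n + 1) + (n + 1) := Nat.succ_mul _ _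
      rw [vertexConf_eq (p := i * (n + 1) + n + 1 + j) _ _ _ _ (by rw [hpos]; omega)
          (k := m * (n + 1) - ((i + 1) * (n + 1) + j)) (by omega),
        vertexConf_eq (p := i * (n + 1) + j) _ _ _ _ (by simp [tapePos, step, val_prev])
          (k := m * (n + 1) - ((i + 1) * (n + 1) + j) + j + n + 1 - j) (by omega)]
      exact h.mono (by omega)

/-! ### From moves to the whole computation -/

section Steps

variable (d : Dir) (half : Bool) (D : Vertex m n → Dir) (u : Vertex m n)

theorem rightPart_at : rightPart (word D) (tapePos u) (m * (n + 1) - tapePos u) =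
    (D u).symbol :: rightPart (word D) (tapePos u + 1) (m * (n + 1) - tapePos u - 1) := by
  have := tapePos_lt u
  rw [show m * (n + 1) - tapePos u = m * (n + 1) - tapePos u - 1 + 1 by omega, rightPart_succ,
    word_tapePos, Nat.add_sub_cancel]

theorem rightPart_update_at (k : ℕ) : rightPart (word (Function.update D u d)) (tapePos u + 1) k =
    rightPart (word D) (tapePos u + 1) k := by
  rw [word_update, rightPart_update]

theorem leftPart_update_at : leftPart (word (Function.update D u d)) (tapePos u) =
    leftPart (word D) (tapePos u) := by
  rw [word_update, leftPart_update]

theorem step_start : TM2.step program (vertexConf .start d half D u) =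
    some (vertexConf (moveLabel (D u)) (D u) false D u) := by
  simp [vertexConf, conf, program, look, move, rightPart_at, dirOfSymbol_symbol]

theorem step_black : TM2.step program (vertexConf .arrive d false D u) =
    some (vertexConf (moveLabel d) d true (Function.update D u d) u) := by
  simp [vertexConf, conf, program, take, write, move, rightPart_at, rightPart_update_at,
    leftPart_update_at]

/-- The old symbol is read before the cell is overwritten: it determines where the walk goes, while
the new one points back to where it came from. -/
theorem step_white (hu : tapePos u ≠ 0) : TM2.step program (vertexConf .arrive d true D u) =
    some (vertexConf (moveLabel (D u)) (D u) false (Function.update D u d.opp) u) := by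
  obtain ⟨p, hp⟩ := Nat.exists_eq_succ_of_ne_zero hu
  have hl : leftPart (word D) (tapePos u) ≠ [] := by rw [hp]; simp
  simp [vertexConf, conf, program, look, take, write, move, ifEmpty, rightPart_at,
    rightPart_update_at, leftPart_update_at, dirOfSymbol_symbol, hl]

theorem step_halt (hu : tapePos u = 0) : TM2.step program (vertexConf .arrive d true D u) =
    some ⟨none, (none, .east, false),
      stackFn [] (rightPart (word (Function.update D u d.opp)) 0 (m * (n + 1))) []⟩ := by
  have h := rightPart_at (Function.update D u d.opp) u
  have h' := rightPart_at D u
  rw [rightPart_update_at, Function.update_self] at h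
  rw [hu, Nat.sub_zero] at h h'
  simp [vertexConf, conf, program, look, take, write, ifEmpty, hu, h, h']

end Steps

/-- The configuration of the machine in a state of the walk. -/
def walkConf (S : WalkState m n) : Conf := vertexConf .arrive S.last true S.dirs S.pos

theorem runs_walkStep (S : WalkState m n) (hS : tapePos S.pos ≠ 0) :
    RunsIn (2 * moveTime m n + 2) (walkConf S) (walkConf (walkStep S)) := by
  have h1 := (RunsIn.single (step_white S.last S.dirs S.pos hS)).trans (runs_move _ _ _ _)
  have h2 := (RunsIn.single (step_black (S.dirs S.pos) (Function.update S.dirs S.pos S.last.opp)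
    (step S.pos (S.dirs S.pos)))).trans (runs_move _ _ _ _)
  exact (h1.trans h2).mono (by omega)

/-- The machine writes nothing at the start vertex. This agrees with the first step of the walk,
which rewrites the direction already present, and it avoids the halting test at the corner. -/
theorem runs_walkStart (d : Dir) (half : Bool) (D : Vertex m n → Dir) (w : Vertex m n) :
    RunsIn (2 * moveTime m n + 2) (vertexConf .start d half D w)
      (walkConf (walkStep (walkStart D w))) := by
  have h1 := (RunsIn.single (step_start d half D w)).trans (runs_move _ _ _ _)
  have h2 := (RunsIn.single (step_black (D w) D (step w (D w)))).trans (runs_move _ _ _ _)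
  have h3 : walkConf (walkStep (walkStart D w)) = vertexConf .arrive (D w) true
      (Function.update D (step w (D w)) (D w)) (step (step w (D w)) (D w)) := by
    simp [walkConf, walkStep, walkStart]
  rw [h3]
  exact (h1.trans h2).mono (by omega)

theorem runs_shiftCycle (hm : 0 < m) (hn : 0 < n) (hm' : Even m) (hn' : Even n)
    {D : Vertex m n → Dir} (hD : IsPairing D) :
    RunsIn (2 * (m * n) * (2 * moveTime m n + 2) + 1)
      (vertexConf .start .east false D (corner hm hn))
      ⟨none, (none, .east, false),
        stackFn [] (rightPart (word (shiftCycle D (corner hm hn))) 0 (m * (n + 1))) []⟩ := by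
  obtain ⟨k, h0, hk, hne, hend, hres⟩ := exists_walk hm' hn' (isWhite_corner hm hn) hD
  -- The machine's halting test is thus exactly the return of the walk to the corner.
  have hpos : ∀ u : Vertex m n, tapePos u = 0 ↔ u = corner hm hn := by
    intro u
    rw [← tapePos_injective.eq_iff]
    simp [tapePos, corner]
  have main : ∀ i, i + 1 ≤ k → RunsIn ((i + 1) * (2 * moveTime m n + 2))
      (vertexConf .start .east false D (corner hm hn))
      (walkConf (walkStep^[i + 1] (walkStart D (corner hm hn)))) := by
    intro i
    induction i with
    | zero =>
      intro _
      rw [Nat.zero_add, Nat.one_mul]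
      exact runs_walkStart _ _ _ _
    | succ i ih =>
      intro hi
      rw [Function.iterate_succ_apply', Nat.succ_mul]
      refine (ih (by omega)).trans (runs_walkStep _ ?_)
      rw [ne_eq, hpos]
      exact hne _ (by omega) (by omega)
  have h1 := main (k - 1) (by omega)
  rw [Nat.sub_add_cancel h0] at h1
  have h2 := step_halt (walkStep^[k] (walkStart D (corner hm hn))).last
    (walkStep^[k] (walkStart D (corner hm hn))).dirs _ ((hpos _).2 hend)
  rw [hend, hres] at h2
  refine (h1.trans (RunsIn.single (y := _) ?_)).mono
    (Nat.add_le_add_right (Nat.mul_le_mul_right _ hk) 1)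
  rw [walkConf, hend]
  exact h2

theorem range_mul_eq_flatMap (m k : ℕ) :
    List.range (m * k) = (List.range m).flatMap fun i => (List.range k).map (i * k + ·) := by
  induction m with
  | zero => simp
  | succ m ih =>
    rw [Nat.succ_mul, List.range_add, List.range_succ, List.flatMap_append, ← ih]
    simp

theorem symbolAt_eq (hm : 2 ≤ m) (hn : 2 ≤ n) (M : PerfectMatching m n) (i : Fin m) (j : Fin n) :
    symbolAt M.val i j = (dirOf M (i, j)).symbol := by
  have h := edgeAt_mem_iff_dirOf hm hn M (i, j)
  simp only [symbolAt, Dir.symbol, ← h, edgeAt]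

/-- The four bits of a cell contain exactly one true entry, so the given encoding of a matching
coincides with the tape of its directions. -/
theorem encode_eq (x : Input) :
    encode x = rightPart (word (dirOf x.M)) 0 (x.m * (x.n + 1)) := by
  have hm := two_le_of_pos_of_even x.m_pos x.m_even
  have hn := two_le_of_pos_of_even x.n_pos x.n_even
  rw [rightPart, ← List.range_eq_range', range_mul_eq_flatMap, List.map_flatMap,
    ← List.map_coe_finRange_eq_range (n := x.m), List.flatMap_map, encode]
  congr 1
  funext i
  rw [encodeRow, List.range_succ, ← List.map_coe_finRange_eq_range (n := x.n)]
  simp only [List.map_append, List.map_map, List.map_cons, List.map_nil, word_end]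
  congr 1
  refine List.map_congr_left fun j _ => ?_
  rw [symbolAt_eq hm hn]
  exact (word_tapePos (dirOf x.M) (i, j)).symm

/-! ### Polynomial-time computability -/

/-- The machine. -/
def machine : FinTM2 where
  K := Stk
  k₀ := .right
  k₁ := .right
  Γ := fun _ => Symbol
  Λ := Label
  main := .start
  σ := Reg
  initialState := (none, .east, false)
  Γk₀Fin := inferInstanceAs (Fintype Symbol)
  m := program

theorem initList_machine (s : List Symbol) :
    initList machine (s.map (Equiv.refl Symbol).invFun) =
      (⟨some .start, (none, .east, false), stackFn [] s []⟩ : Conf) := by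
  have h : s.map (Equiv.refl Symbol).invFun = s := List.map_id s
  refine Eq.trans (congrArg (initList machine) h) ?_
  simp only [initList]
  congr 1
  funext k
  cases k <;> rfl

theorem haltList_machine (s : List Symbol) :
    haltList machine (s.map (Equiv.refl Symbol).invFun) =
      (⟨none, (none, .east, false), stackFn [] s []⟩ : Conf) := by
  have h : s.map (Equiv.refl Symbol).invFun = s := List.map_id s
  refine Eq.trans (congrArg (haltList machine) h) ?_
  simp only [haltList]
  congr 1
  funext k
  cases k <;> rfl

/-- The time bound of the machine. -/
noncomputable def timeBound : Polynomial ℕ :=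
  2 * Polynomial.X * (2 * (5 * Polynomial.X + 10) + 2) + 1

theorem polyTimeComputable_flipMatching : PolyTimeComputable flipMatching := by
  refine ⟨⟨⟨machine, Equiv.refl _, Equiv.refl _⟩, timeBound, fun x => ?_⟩⟩
  have hm := two_le_of_pos_of_even x.m_pos x.m_even
  have hn := two_le_of_pos_of_even x.n_pos x.n_even
  have key := runs_shiftCycle x.m_pos x.n_pos x.m_even x.n_even (isPairing_dirOf hm hn x.M)
  have hstart : vertexConf .start .east false (dirOf x.M) (corner x.m_pos x.n_pos) =
      initList machine ((encode x).map (Equiv.refl Symbol).invFun) := by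
    rw [initList_machine, encode_eq]
    simp [vertexConf, conf, tapePos, corner]
  have hhalt : (⟨none, (none, .east, false), stackFn [] (rightPart (word (shiftCycle (dirOf x.M)
      (corner x.m_pos x.n_pos))) 0 (x.m * (x.n + 1))) []⟩ : Conf) =
      haltList machine ((encode { x with M := flipMatching x.m x.n x.M }).map
        (Equiv.refl Symbol).invFun) := by
    rw [haltList_machine, encode_eq, dirOf_flipMatching x.m_pos x.m_even x.n_pos x.n_even]
  have htime : 2 * (x.m * x.n) * (2 * moveTime x.m x.n + 2) + 1 ≤
      timeBound.eval (encode x).length := by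
    rw [length_encode]
    simp only [timeBound, moveTime, Polynomial.eval_add, Polynomial.eval_mul, Polynomial.eval_X,
      Polynomial.eval_ofNat, Polynomial.eval_one]
    gcongr
    omega
  rw [hstart, hhalt] at key
  exact ⟨⟨key.choose, key.choose_spec.2⟩, key.choose_spec.1.trans htime⟩

end ToroidalGrid

open ToroidalGrid in
theorem theorem2 :
    ∃ Φ Ψ : ∀ m n : ℕ, PerfectMatching m n → PerfectMatching m n,
      PolyTimeComputable Φ ∧ PolyTimeComputable Ψ ∧
      ∀ m n : ℕ, 0 < m → Even m → 0 < n → Even n →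
        ∀ (a : Fin n) (b : Fin m) (h : Fin m → ℕ) (v : Fin n → ℕ),
          Set.BijOn (Φ m n)
            (evenMatchings (horizontalLayer a) (verticalLayer b) h v)
            (oddMatchings (horizontalLayer a) (verticalLayer b) h v) ∧
          Set.InvOn (Ψ m n) (Φ m n)
            (evenMatchings (horizontalLayer a) (verticalLayer b) h v)
            (oddMatchings (horizontalLayer a) (verticalLayer b) h v) ∧
          (evenMatchings (horizontalLayer a) (verticalLayer b) h v).ncard =
            (oddMatchings (horizontalLayer a) (verticalLayer b) h v).ncard := by
  -- The map is an involution, so the same algorithm also computes the inverse.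
  refine ⟨flipMatching, flipMatching, polyTimeComputable_flipMatching,
    polyTimeComputable_flipMatching, fun m n hm hm' hn hn' a b h v => ?_⟩
  have hbij := bijOn_flipMatching hm hm' hn hn' a b h v
  have hinv := flipMatching_flipMatching hm hm' hn hn'
  refine ⟨hbij, ⟨fun M _ => hinv M, fun M _ => hinv M⟩, ?_⟩
  rw [← hbij.image_eq, hbij.injOn.ncard_image]
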